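/- Let $D$ be a planar diagram of an oriented link, and let $\sigma_D$ be its orientation-induced smoothing, in which each positive crossing is $0$-smoothed and each negative crossing is $1$-smoothed; its components are the Seifert circles. The trace state graph $\Gamma_{\sigma_D}$ is the multigraph whose vertices are the Seifert circles, with one edge (trace) for each crossing, joining the two circles that meet there. Let $\Gamma_0$ be the subgraph consisting of the $0$-traces (that is, of the positive crossings) and their endpoints, and let $b^1$ denote the first Betti number. An enhanced state on $\sigma_D$ is a labelling of the Seifert circles by $1$ or $x$; such labellings are generators of the Khovanov chain group $\mathcal{C}\mathrm{Kh}(D)$ over $\mathbb{Z}$. Let $\Sigma_D$ be the Seifert surface obtained from $D$ by Seifert's algorithm, viewed as a link cobordism $\emptyset\to D$ by a movie that births all Seifert disks, then performs one negative twist-and-glue move (a negative Reidemeister I move followed by a saddle) for each negative crossing, and then one positive twist-and-glue move (a positive Reidemeister I move followed by a saddle) for each positive crossing, in any order. Its relative Khovanov-Jacobsson cycle $\mathcal{C}\mathrm{KJ}_{\Sigma_D}\in\mathcal{C}\mathrm{Kh}(D)$ is the image of $1\in\mathcal{C}\mathrm{Kh}(\emptyset)=\mathbb{Z}$ under the composition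 of the chain maps of these moves. It depends on the choices in the movie only up to an overall sign. The cycle $\mathcal{C}\mathrm{KJ}_{\Sigma_D}$ is determined, up to an overall sign, by the graph $\Gamma_0$ through first Betti numbers, as follows. If $\Gamma_0$ is connected (in particular non-empty), then, up to an overall sign: (a) if $b^1(\Gamma_0)=0$, then for every vertex $v_0$ of $\Gamma_0$, $$\mathcal{C}\mathrm{KJ}_{\Sigma_D}=\pm\sum_{v\in V(\Gamma_0)}(-1)^{d(v_0,v)}\,\alpha_v ,$$ where $d$ is the distance in $\Gamma_0$ and $\alpha_v$ is the enhanced state on $\sigma_D$ in which $v$ is labelled $1$, all other vertices of $\Gamma_0$ are labelled $x$, and all Seifert circles not in $\Gamma_0$ are labelled $1$ (a $pqr$-chain on the vertices of $\Gamma_0$); (b) if $b^1(\Gamma_0)=1$, then $\mathcal{C}\mathrm{KJ}_{\Sigma_D}=\pm 2\alpha$, where $\alpha$ is the enhanced state on $\sigma_D$ with label $x$ on the vertices of $\Gamma_0$ and label $1$ on all other Seifert circles; (c) if $b^1(\Gamma_0)\ge 2$, then $\mathcal{C}\mathrm{KJ}_{\Sigma_D}=0$. For arbitrary $\Gamma_0$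 the description applies to each connected component: up to an overall sign, $\mathcal{C}\mathrm{KJ}_{\Sigma_D}$ is the tensor product, over the components $K$ of $\Gamma_0$, of the chain on the vertices of $K$ given by (a), (b) or (c) according to $b^1(K)$, with the label $1$ on all Seifert circles that are not in $\Gamma_0$. -/

import Mathlib

/-- An oriented link diagram in the plane, up to planar isotopy, in combinatorial form.

`Pt` is a finite set of points on the diagram: each crossing contributes two points, its *ports*,
and the points that are not ports are markings on the strands (a component of the diagram without
crossings carries at least one of these).  Draw each crossing with both strands
pointing up and smooth it according to the orientation, as `) (`; the left strand then carries
the port `(c, false)` and the right one the port `(c, true)`.  The smoothed curve is a collection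
of oriented circles, and `next p` is the point that follows `p`.  So the diagram has one arc for
every `p : Pt`, which leaves `p` and runs to `next p`: it leaves a crossing at the top left
(top right) if `p` is a left (right) port, and it enters a crossing from the
bottom left (bottom right) if `next p` is a left (right) port.  `pos c` records whether the crossing
is positive, that is, whether the overstrand runs from the bottom left to the top right. -/
structure LinkDiagram where
  Pt : Type
  Cr : Type
  [finPt : Finite Pt]
  [finCr : Finite Cr]
  next : Equiv.Perm Pt
  port : Cr × Bool ↪ Pt
  pos : Cr → Bool

attribute [instance] LinkDiagram.finPt LinkDiagram.finCr

/-- The labels of an enhanced state. -/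
inductive KhLabel where
  | one : KhLabel
  | x : KhLabel

instance : Finite KhLabel :=
  Finite.of_surjective (fun b : Bool => cond b KhLabel.one KhLabel.x) (by
    intro l
    cases l
    · exact ⟨true, rfl⟩
    · exact ⟨false, rfl⟩)

namespace LinkDiagram

/-! ### Planarity -/

/-- `D.SameRegion a b`: two sides of arcs that follow each other along the boundary of a region of
the diagram.  The left side of the arc `p` is `(p, true)`, its right side is `(p, false)`. -/
inductive SameRegion (D : LinkDiagram) : D.Pt × Bool → D.Pt × Bool → Prop
  | mark (p : D.Pt) (h : p ∉ Set.range D.port) (side : Bool) :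
      D.SameRegion (D.next.symm p, side) (p, side)
  | west (c : D.Cr) :
      D.SameRegion (D.next.symm (D.port (c, false)), true) (D.port (c, false), true)
  | east (c : D.Cr) :
      D.SameRegion (D.next.symm (D.port (c, true)), false) (D.port (c, true), false)
  | south (c : D.Cr) :
      D.SameRegion (D.next.symm (D.port (c, false)), false) (D.next.symm (D.port (c, true)), true)
  | north (c : D.Cr) :
      D.SameRegion (D.port (c, false), false) (D.port (c, true), true)

/-- Adjacency in the 4-valent graph that underlies the diagram. -/
inductive SamePiece (D : LinkDiagram) : D.Pt → D.Pt → Prop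
  | arc (p : D.Pt) : D.SamePiece p (D.next p)
  | crossing (c : D.Cr) : D.SamePiece (D.port (c, false)) (D.port (c, true))

/-- The diagram can be drawn in the plane: every connected piece of the underlying 4-valent graph,
with the cyclic order of the edges at the crossings, has genus zero.  Since there are
`|Pt| - |Cr|` vertices (crossings and markings) and `|Pt|` edges, Euler's formula, summed over the
connected pieces, is the equation below. -/
def Planar (D : LinkDiagram) : Prop :=
  Nat.card (Quot D.SameRegion) = Nat.card D.Cr + 2 * Nat.card (Quot D.SamePiece)

/-! ### States, enhanced states and the Khovanov chain group -/

/-- A state: `false` stands for the 0-smoothing of a crossing and `true` for the 1-smoothing. -/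
abbrev State (D : LinkDiagram) : Type := D.Cr → Bool

/-- The orientation-induced smoothing: positive crossings are 0-smoothed and
negative crossings are 1-smoothed. -/
def orientedState (D : LinkDiagram) : D.State := fun c => !(D.pos c)

/-- Arcs that are directly connected in the state `σ`.  At a crossing, one of the two smoothings is
`) (`, which respects the orientation (the 0-smoothing of a positive crossing and the 1-smoothing
of a negative one), and the other one joins the two incoming arcs, and the two outgoing arcs. -/
inductive Joins (D : LinkDiagram) (σ : D.State) : D.Pt → D.Pt → Prop
  | mark (p : D.Pt) (h : p ∉ Set.range D.port) : D.Joins σ (D.next.symm p) p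
  | through (c : D.Cr) (b : Bool) (h : σ c = D.orientedState c) :
      D.Joins σ (D.next.symm (D.port (c, b))) (D.port (c, b))
  | incoming (c : D.Cr) (h : σ c ≠ D.orientedState c) :
      D.Joins σ (D.next.symm (D.port (c, false))) (D.next.symm (D.port (c, true)))
  | outgoing (c : D.Cr) (h : σ c ≠ D.orientedState c) :
      D.Joins σ (D.port (c, false)) (D.port (c, true))

/-- The components (loops) of the state `σ`. -/
def Loop (D : LinkDiagram) (σ : D.State) : Type := Quot (D.Joins σ)

/-- The loop of the state `σ` that contains the arc `p`. -/
def loop (D : LinkDiagram) (σ : D.State) (p : D.Pt) : D.Loop σ := Quot.mk _ p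

instance (D : LinkDiagram) (σ : D.State) : Finite (D.Loop σ) :=
  inferInstanceAs (Finite (Quot (D.Joins σ)))

/-- An enhanced state: a state whose components are labelled with `1` or `x`. -/
abbrev EnhancedState (D : LinkDiagram) : Type := (σ : D.State) × (D.Loop σ → KhLabel)

/-- The label that an enhanced state gives to the component containing the arc `p`. -/
def label {D : LinkDiagram} (s : D.EnhancedState) (p : D.Pt) : KhLabel := s.2 (D.loop s.1 p)

noncomputable instance (D : LinkDiagram) : Fintype D.EnhancedState := Fintype.ofFinite _

/-- The Khovanov chain group: the free abelian group on the (finitely many) enhanced states. -/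
abbrev Chain (D : LinkDiagram) : Type := D.EnhancedState → ℤ

open Classical in
/-- An enhanced state as a generator of the chain group. -/
noncomputable def gen {D : LinkDiagram} (s : D.EnhancedState) : D.Chain := Pi.single s 1

/-- The homomorphism of chain groups that takes the generator `s` to `∑ s', a s s' • s'`. -/
noncomputable def ofCoeff {D D' : LinkDiagram} (a : D.EnhancedState → D'.EnhancedState → ℤ) :
    D.Chain →ₗ[ℤ] D'.Chain :=
  Matrix.mulVecLin (Matrix.of fun s' s => a s s')

/-! ### Elementary moves and their maps -/

/-- The empty diagram. -/
def empty : LinkDiagram where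
  Pt := Empty
  Cr := Empty
  next := Equiv.refl _
  port := ⟨fun a => a.1, fun a => a.1.elim⟩
  pos := fun c => c.elim

/-- The birth of a circle without crossings. -/
def birth (D : LinkDiagram) : LinkDiagram where
  Pt := Option D.Pt
  Cr := D.Cr
  next := D.next.optionCongr
  port := D.port.trans Function.Embedding.some
  pos := D.pos

open Classical in
/-- The map of a birth: the new circle is labelled `1`. -/
noncomputable def birthMap (D : LinkDiagram) : D.Chain →ₗ[ℤ] D.birth.Chain :=
  ofCoeff fun s s' =>
    if s'.1 = s.1 ∧ (∀ p : D.Pt, label s' (some p) = label s p) ∧ label s' none = KhLabel.one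
    then 1 else 0

open Classical in
/-- A Reidemeister I move that adds a kink on the arc `p`, with a positive crossing if
`sgn = true` and a negative one if `sgn = false`.  In the smoothing `) (` of the
new crossing, the strand on the side `side` (left for `false`, right for `true`)
belongs to the arc `p`, and the other strand closes up to a small circle. -/
noncomputable def kink (D : LinkDiagram) (p : D.Pt) (sgn side : Bool) : LinkDiagram where
  Pt := D.Pt ⊕ Bool
  Cr := Option D.Cr
  next := (Equiv.sumCongr D.next (Equiv.refl Bool)) * Equiv.swap (Sum.inl p) (Sum.inr side)
  port :=
    { toFun := fun a => match a with
        | (some c, b) => Sum.inl (D.port (c, b))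
        | (none, b) => Sum.inr b
      inj' := by
        rintro ⟨_ | c, b⟩ ⟨_ | c', b'⟩ h <;> simp_all }
  pos := fun c => c.elim sgn D.pos

open Classical in
/-- The map of a Reidemeister I move.  It takes values in the states in which the new crossing has
its orientation-induced smoothing, which splits off a small circle.
* For a positive kink, a label `a` on the loop through the arc becomes `a ⊗ x - (x a) ⊗ 1`, where
  the second factor is the label of the small circle and `x · 1 = x`, `x · x = 0`.
* For a negative kink, it becomes `a ⊗ 1`. -/
noncomputable def kinkMap (D : LinkDiagram) (p : D.Pt) (sgn side : Bool) :
    D.Chain →ₗ[ℤ] (D.kink p sgn side).Chain :=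
  ofCoeff fun s s' =>
    if (∀ c : D.Cr, s'.1 (some c) = s.1 c) ∧ s'.1 none = !sgn then
      if sgn then
        (if (∀ q : D.Pt, label s' (Sum.inl q) = label s q) ∧
            label s' (Sum.inr !side) = KhLabel.x then 1 else 0)
        - (if label s p = KhLabel.one ∧
            (∀ q : D.Pt, label s' (Sum.inl q) =
              if D.loop s.1 q = D.loop s.1 p then KhLabel.x else label s q) ∧
            label s' (Sum.inr !side) = KhLabel.one then 1 else 0)
      else
        (if (∀ q : D.Pt, label s' (Sum.inl q) = label s q) ∧
            label s' (Sum.inr !side) = KhLabel.one then 1 else 0)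
    else 0

open Classical in
/-- An (oriented) Morse saddle along a band that joins the arcs `p` and `q`. -/
noncomputable def saddle (D : LinkDiagram) (p q : D.Pt) : LinkDiagram where
  Pt := D.Pt
  Cr := D.Cr
  next := D.next * Equiv.swap p q
  port := D.port
  pos := D.pos

/-- The multiplication `1 · 1 = 1`, `1 · x = x · 1 = x`, `x · x = 0`: the coefficient of `c`
in `a · b`. -/
def mulCoeff : KhLabel → KhLabel → KhLabel → ℤ
  | .one, .one, .one => 1
  | .one, .x, .x => 1
  | .x, .one, .x => 1
  | _, _, _ => 0

/-- The comultiplication `1 ↦ 1 ⊗ x + x ⊗ 1`, `x ↦ x ⊗ x`: the coefficient of `b ⊗ c` in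
the image of `a`. -/
def comulCoeff : KhLabel → KhLabel → KhLabel → ℤ
  | .one, .one, .x => 1
  | .one, .x, .one => 1
  | .x, .x, .x => 1
  | _, _, _ => 0

open Classical in
/-- The map of a saddle.  In each state, it merges two loops, by the multiplication, or splits
a loop into two, by the comultiplication, and keeps the labels of all other loops. -/
noncomputable def saddleMap (D : LinkDiagram) (p q : D.Pt) :
    D.Chain →ₗ[ℤ] (D.saddle p q).Chain :=
  ofCoeff fun s s' =>
    if s'.1 = s.1 ∧ (∀ r : D.Pt, D.loop s.1 r ≠ D.loop s.1 p → D.loop s.1 r ≠ D.loop s.1 q →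
        label (D := D.saddle p q) s' r = label s r) then
      if D.loop s.1 p ≠ D.loop s.1 q then
        mulCoeff (label s p) (label s q) (label (D := D.saddle p q) s' p)
      else if (D.saddle p q).loop s'.1 p ≠ (D.saddle p q).loop s'.1 q then
        comulCoeff (label s p) (label (D := D.saddle p q) s' p) (label (D := D.saddle p q) s' q)
      else 0
    else 0

/-- `Thinning D D'`: the diagram `D'` is the diagram `D` with some (possibly no) markings deleted,
up to renaming of points and crossings.  At least one point is kept on each circle. -/
structure Thinning (D D' : LinkDiagram) where
  pt : D'.Pt → D.Pt
  cr : D'.Cr ≃ D.Cr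
  pt_injective : Function.Injective pt
  pt_port : ∀ (c : D'.Cr) (b : Bool), pt (D'.port (c, b)) = D.port (cr c, b)
  pos_cr : ∀ c : D'.Cr, D'.pos c = D.pos (cr c)
  /-- `next` of `D'` is the first return of `next` of `D` to the points that are kept. -/
  pt_next : ∀ p : D'.Pt, ∃ k : ℕ, (D.next ^ (k + 1)) (pt p) = pt (D'.next p) ∧
    ∀ j < k, (D.next ^ (j + 1)) (pt p) ∉ Set.range pt
  pt_meets : ∀ q : D.Pt, ∃ k : ℕ, (D.next ^ k) q ∈ Set.range pt

/-- Enhanced states of a diagram and of a thinning of it that are the same picture. -/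
def Thinning.Same {D D' : LinkDiagram} (t : Thinning D D') (s : D.EnhancedState)
    (s' : D'.EnhancedState) : Prop :=
  (∀ c : D'.Cr, s'.1 c = s.1 (t.cr c)) ∧ ∀ p : D'.Pt, label s' p = label s (t.pt p)

open Classical in
/-- The identification of chain groups when markings are deleted. -/
noncomputable def Thinning.map {D D' : LinkDiagram} (t : Thinning D D') :
    D.Chain →ₗ[ℤ] D'.Chain :=
  ofCoeff fun s s' => if t.Same s s' then 1 else 0

open Classical in
/-- The identification of chain groups when markings are added. -/
noncomputable def Thinning.mapBack {D D' : LinkDiagram} (t : Thinning D D') :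
    D'.Chain →ₗ[ℤ] D.Chain :=
  ofCoeff fun s' s => if t.Same s s' then 1 else 0

/-! ### The movie of Seifert's algorithm -/

/-- The twist-and-glue move: a Reidemeister I move on the arc `p`, followed by a saddle that joins
the outer side of the kink to the arc `q`.  It puts a new crossing (positive if `sgn = true`)
between the arcs `p` and `q`, realised by a twisted band. -/
noncomputable def twistGlue (D : LinkDiagram) (p q : D.Pt) (sgn side : Bool) : LinkDiagram :=
  (D.kink p sgn side).saddle (Sum.inr !side) (Sum.inl q)

/-- The map of the twist-and-glue move. -/
noncomputable def twistGlueMap (D : LinkDiagram) (p q : D.Pt) (sgn side : Bool) :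
    D.Chain →ₗ[ℤ] (D.twistGlue p q sgn side).Chain :=
  (D.kink p sgn side).saddleMap (Sum.inr !side) (Sum.inl q) ∘ₗ D.kinkMap p sgn side

/-- The three scenes of the movie. -/
inductive Scene where
  | births : Scene
  | negative : Scene
  | positive : Scene

/-- The movies of Seifert's algorithm, up to a frame `D` in a given scene.  The movie starts from
the empty diagram; in the first scene circles are born, in the second negative
twist-and-glue moves are performed, in the third positive ones.  In between, the
frames may be changed by planar isotopy, that is, points and crossings may be renamed and markings
may be deleted or added. -/
inductive Film : Scene → LinkDiagram → Type 1
  | start : Film .births LinkDiagram.empty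
  | birth {D : LinkDiagram} (m : Film .births D) : Film .births D.birth
  | beginNegative {D : LinkDiagram} (m : Film .births D) : Film .negative D
  | negativeTwistGlue {D : LinkDiagram} (m : Film .negative D) (p q : D.Pt) (side : Bool) :
      Film .negative (D.twistGlue p q false side)
  | beginPositive {D : LinkDiagram} (m : Film .negative D) : Film .positive D
  | positiveTwistGlue {D : LinkDiagram} (m : Film .positive D) (p q : D.Pt) (side : Bool) :
      Film .positive (D.twistGlue p q true side)
  | thin {i : Scene} {D D' : LinkDiagram} (m : Film i D) (t : Thinning D D') : Film i D'
  | thicken {i : Scene} {D D' : LinkDiagram} (m : Film i D) (t : Thinning D' D) : Film i D'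

/-- The image of `1` under the composition of the maps of the moves of the movie. -/
noncomputable def Film.chain : {i : Scene} → {D : LinkDiagram} → Film i D → D.Chain
  | _, _, .start => fun _ => 1
  | _, _, .birth m => birthMap _ m.chain
  | _, _, .beginNegative m => m.chain
  | _, _, .negativeTwistGlue m p q side => twistGlueMap _ p q false side m.chain
  | _, _, .beginPositive m => m.chain
  | _, _, .positiveTwistGlue m p q side => twistGlueMap _ p q true side m.chain
  | _, _, .thin m t => t.map m.chain
  | _, _, .thicken m t => t.mapBack m.chain

/-- A movie, from the empty diagram to `D`, of the surface that Seifert's algorithm associates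
to `D`: births of the Seifert disks, then one negative twist-and-glue move for every
negative crossing, then one positive twist-and-glue move for every positive crossing. -/
abbrev SeifertMovie (D : LinkDiagram) : Type 1 := Film .positive D

/-- The relative Khovanov-Jacobsson cycle of the Seifert surface, computed from a movie. -/
noncomputable def SeifertMovie.cycleKJ {D : LinkDiagram} (m : D.SeifertMovie) : D.Chain := m.chain

/-! ### Trace state graphs -/

/-- The two loops of the state `σ` joined by the trace at the crossing `c`. -/
def traceEnd (D : LinkDiagram) (σ : D.State) (c : D.Cr) : Bool → D.Loop σ
  | false => D.loop σ (D.port (c, false))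
  | true => if σ c = D.orientedState c then D.loop σ (D.port (c, true))
      else D.loop σ (D.next.symm (D.port (c, false)))

/-- The 0-traces of `σ`. -/
def zeroTraces (D : LinkDiagram) (σ : D.State) : Set D.Cr := {c | σ c = false}

/-- The vertices of the subgraph `Γ₀` of the trace state graph of `σ` that
consists of the 0-traces: the loops at the end of some 0-trace. -/
def zeroLoops (D : LinkDiagram) (σ : D.State) : Set (D.Loop σ) :=
  {v | ∃ c ∈ D.zeroTraces σ, ∃ b : Bool, D.traceEnd σ c b = v}

/-- Adjacency in the graph `Γ₀`.  Multiple edges count in `firstBetti`, not here. -/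
def zeroGraph (D : LinkDiagram) (σ : D.State) : SimpleGraph (D.zeroLoops σ) :=
  SimpleGraph.fromRel fun v w =>
    ∃ c ∈ D.zeroTraces σ, D.traceEnd σ c false = v ∧ D.traceEnd σ c true = w

open Classical in
/-- The rational 1-cycles of the multigraph whose vertices are the loops of `σ` and whose
edges are the traces in `E`. -/
noncomputable def cycleSpace (D : LinkDiagram) (σ : D.State) (E : Set D.Cr) :
    Submodule ℚ (D.Cr → ℚ) where
  carrier := {w | (∀ c, c ∉ E → w c = 0) ∧
    ∀ v : D.Loop σ, (∑ᶠ c : D.Cr, if D.traceEnd σ c true = v then w c else 0) =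
      ∑ᶠ c : D.Cr, if D.traceEnd σ c false = v then w c else 0}
  zero_mem' := ⟨fun _ _ => rfl, fun v => by simp⟩
  add_mem' := by
    rintro a b ⟨ha, ha'⟩ ⟨hb, hb'⟩
    refine ⟨fun c hc => by simp [ha c hc, hb c hc], fun v => ?_⟩
    have key : ∀ i : Bool, (∑ᶠ c : D.Cr, if D.traceEnd σ c i = v then (a + b) c else 0) =
        (∑ᶠ c : D.Cr, if D.traceEnd σ c i = v then a c else 0) +
        ∑ᶠ c : D.Cr, if D.traceEnd σ c i = v then b c else 0 := by
      intro i
      rw [← finsum_add_distrib (Set.toFinite _) (Set.toFinite _)]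
      refine finsum_congr fun c => ?_
      by_cases h : D.traceEnd σ c i = v <;> simp [h]
    rw [key, key, ha', hb']
  smul_mem' := by
    rintro r a ⟨ha, ha'⟩
    refine ⟨fun c hc => by simp [ha c hc], fun v => ?_⟩
    have key : ∀ i : Bool, (∑ᶠ c : D.Cr, if D.traceEnd σ c i = v then (r • a) c else 0) =
        r * ∑ᶠ c : D.Cr, if D.traceEnd σ c i = v then a c else 0 := by
      intro i
      rw [mul_finsum]
      refine finsum_congr fun c => ?_
      by_cases h : D.traceEnd σ c i = v <;> simp [h]
    rw [key, key, ha']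

/-- The first Betti number of the multigraph formed by the traces in `E`. -/
noncomputable def firstBetti (D : LinkDiagram) (σ : D.State) (E : Set D.Cr) : ℕ :=
  Module.finrank ℚ (D.cycleSpace σ E)

/-- The edges of a connected component `K` of `Γ₀`. -/
def componentTraces (D : LinkDiagram) (σ : D.State)
    (K : (D.zeroGraph σ).ConnectedComponent) : Set D.Cr :=
  {c | c ∈ D.zeroTraces σ ∧ ∃ v : D.zeroLoops σ, v.1 = D.traceEnd σ c false ∧
    (D.zeroGraph σ).connectedComponentMk v = K}

/-! ### The chains in the description of the cycle -/

open Classical in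
/-- The enhanced state on `σ` that has the label `x` on the loops in `S` and `1` elsewhere. -/
noncomputable def xOn (D : LinkDiagram) (σ : D.State) (S : Set (D.Loop σ)) : D.EnhancedState :=
  ⟨σ, fun v => if v ∈ S then KhLabel.x else KhLabel.one⟩

/-- The `pqr`-chain on the loops in `S`, with the sign `sgn v` on the summand in which `v` is the
only 1-labelled loop of `S`.  Loops outside `S` are 1-labelled in all summands. -/
noncomputable def pqrChain (D : LinkDiagram) (σ : D.State) (S : Set (D.Loop σ)) (sgn : S → ℤ) :
    D.Chain :=
  ∑ᶠ v : S, sgn v • gen (D.xOn σ (S \ {v.1}))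

open Classical in
/-- The coefficient with which a labelling `l` of the loops of `σ` occurs, as far as the component
`K` of `Γ₀` is concerned, in a `pqr`-chain on the vertices of `K` with signs given by the
parity of the distance from `v₀` (if `K` has first Betti number 0), or in twice the
labelling with `x` on the vertices of `K` (if it is 1), or in 0 (if it is at least 2). -/
noncomputable def componentCoeff (D : LinkDiagram) (σ : D.State)
    (K : (D.zeroGraph σ).ConnectedComponent) (v₀ : D.zeroLoops σ) (l : D.Loop σ → KhLabel) : ℤ :=
  if D.firstBetti σ (D.componentTraces σ K) = 0 then
    ∑ᶠ v : D.zeroLoops σ,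
      if v ∈ K.supp ∧ ∀ w ∈ K.supp, l w.1 = (if w = v then KhLabel.one else KhLabel.x)
      then (-1) ^ (D.zeroGraph σ).dist v₀ v else 0
  else if D.firstBetti σ (D.componentTraces σ K) = 1 then
    if ∀ w ∈ K.supp, l w.1 = KhLabel.x then 2 else 0
  else 0

open Classical in
/-- The tensor product, over the components `K` of `Γ₀`, of the chains described at
`componentCoeff`, with `1` on the loops that are not in `Γ₀`, as a chain on `σ`. -/
noncomputable def componentwiseChain (D : LinkDiagram) (σ : D.State)
    (base : (D.zeroGraph σ).ConnectedComponent → D.zeroLoops σ) : D.Chain :=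
  ∑ᶠ l : D.Loop σ → KhLabel,
    (if ∀ v, v ∉ D.zeroLoops σ → l v = KhLabel.one then
      ∏ᶠ K : (D.zeroGraph σ).ConnectedComponent, D.componentCoeff σ K (base K) l
    else 0) • gen (⟨σ, l⟩ : D.EnhancedState)

end LinkDiagram

/-! ### Every diagram has a Seifert movie -/

namespace LinkDiagram

/-- Delete the point `p` of a diagram without crossings. -/
noncomputable def dropPerm {P : Type} [DecidableEq P] (f : Equiv.Perm P) (p : P) :
    Equiv.Perm {q : P // q ≠ p} :=
  (Equiv.swap p (f p) * f).subtypePerm (p := fun q => q ≠ p) (by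
    intro q
    simp only [Equiv.Perm.mul_apply]
    have : Equiv.swap p (f p) (f q) = p ↔ q = p := by
      rw [Equiv.swap_apply_eq_iff, Equiv.swap_apply_left, f.injective.eq_iff]
    exact not_congr this)

theorem nonempty_births : ∀ (n : ℕ) (D : LinkDiagram), IsEmpty D.Cr → Nat.card D.Pt = n →
    Nonempty (Film .births D) := by
  classical
  intro n
  induction n with
  | zero =>
    intro D hC hn
    have hP : IsEmpty D.Pt := by
      rcases Nat.card_eq_zero.mp hn with h | h
      · exact h
      · exact absurd D.finPt (not_finite_iff_infinite.mpr h)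
    refine ⟨Film.start.thin ⟨fun p => hP.elim p, Equiv.equivOfIsEmpty (α := D.Cr) (β := Empty),
      fun p => hP.elim p, fun c => hC.elim c, fun c => hC.elim c, fun p => hP.elim p,
      fun q => Empty.elim q⟩⟩
  | succ n ih =>
    intro D hC hn
    have hne : Nonempty D.Pt := by
      by_contra h
      rw [not_nonempty_iff] at h
      simp at hn
    obtain ⟨p⟩ := hne
    let D' : LinkDiagram :=
      { Pt := {q : D.Pt // q ≠ p}, Cr := D.Cr, next := dropPerm D.next p,
        port := ⟨fun a => hC.elim a.1, fun a => hC.elim a.1⟩, pos := D.pos }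
    have hcard : Nat.card D'.Pt = n := by
      have : Nat.card {q : D.Pt // q ≠ p} = Nat.card D.Pt - 1 := by
        have := Fintype.ofFinite D.Pt
        simp
      change Nat.card {q : D.Pt // q ≠ p} = n
      omega
    obtain ⟨m⟩ := ih D' hC hcard
    have hnext : ∀ q : D'.Pt, (D'.next q).1 = if D.next q.1 = p then D.next p else D.next q.1 := by
      intro q
      change Equiv.swap p (D.next p) (D.next q.1) = _
      have h2 : D.next q.1 ≠ D.next p := fun h => q.2 (D.next.injective h)
      split_ifs with h
      · rw [h, Equiv.swap_apply_left]
      · exact Equiv.swap_apply_of_ne_of_ne h h2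
    by_cases hfix : D.next p = p
    · -- `p` is a circle of its own
      refine ⟨m.birth.thin ⟨fun q => if h : q = p then none else some ⟨q, h⟩, Equiv.refl _, ?_,
        fun c => hC.elim c, fun c => hC.elim c, ?_, ?_⟩⟩
      · intro a b hab
        change (if h : a = p then (none : Option {q : D.Pt // q ≠ p}) else some ⟨a, h⟩) =
          if h : b = p then none else some ⟨b, h⟩ at hab
        split_ifs at hab with ha hb
        · exact ha.trans hb.symm
        · exact congrArg Subtype.val (Option.some.inj hab)
      · intro q
        refine ⟨0, ?_, by simp⟩
        by_cases hq : q = p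
        · subst hq
          simp [birth, hfix]
          rfl
        · have h1 : D.next q ≠ p := fun h => hq (D.next.injective (h.trans hfix.symm))
          simp only [hq, h1, dif_neg, not_false_eq_true, zero_add, birth]
          change some (D'.next ⟨q, hq⟩) = _
          congr 1
          apply Subtype.ext
          rw [hnext]
          simp [h1]
      · intro q
        refine ⟨0, ?_⟩
        rcases q with _ | q
        · exact ⟨p, by simp; rfl⟩
        · exact ⟨q.1, by have := q.2; simp [this]; rfl⟩
    · refine ⟨m.thicken ⟨fun q => q.1, Equiv.refl _, Subtype.val_injective,
        fun c => hC.elim c, fun c => rfl, ?_, ?_⟩⟩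
      · intro q
        by_cases hq : D.next q.1 = p
        · refine ⟨1, ?_, ?_⟩
          · rw [hnext, if_pos hq, pow_succ]
            simp [hq]
          · intro j hj
            have : j = 0 := by omega
            subst this
            simp only [zero_add, pow_one, hq]
            rintro ⟨a, ha⟩
            exact a.2 ha
        · exact ⟨0, by rw [hnext, if_neg hq]; simp, by simp⟩
      · intro q
        by_cases hq : q = p
        · exact ⟨1, ⟨D.next q, by rw [hq]; exact hfix⟩, by simp⟩
        · exact ⟨0, ⟨q, hq⟩, by simp⟩

/-- Forget the crossing `c`, that is, smooth it according to the orientation. -/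
def forget (D : LinkDiagram) (c : D.Cr) : LinkDiagram where
  Pt := D.Pt
  Cr := {c' : D.Cr // c' ≠ c}
  next := D.next
  port := ⟨fun a => D.port (a.1.1, a.2), by
    rintro ⟨a, b⟩ ⟨a', b'⟩ h
    have := D.port.injective h
    simp only [Prod.mk.injEq] at this ⊢
    exact ⟨Subtype.ext this.1, this.2⟩⟩
  pos := fun a => D.pos a.1

open Classical in
/-- The successor after a new crossing is inserted right after the points `l` and `r`. -/
noncomputable def insertPerm {P : Type} (f : Equiv.Perm P) (l r : P) : Equiv.Perm (P ⊕ Bool) :=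
  ((Equiv.sumCongr f (Equiv.refl Bool)) * Equiv.swap (Sum.inl l) (Sum.inr false)) *
    Equiv.swap (Sum.inr true) (Sum.inl r)

open Classical in
/-- The inserted points take the place of `l` and `r`. -/
noncomputable def insertPt {P : Type} (l r : P) (p : P) : P ⊕ Bool :=
  if p = l then Sum.inr false else if p = r then Sum.inr true else Sum.inl p

theorem insertPt_injective {P : Type} (l r : P) : Function.Injective (insertPt l r) := by
  intro a b hab
  simp only [insertPt] at hab
  split_ifs at hab <;> simp_all

theorem insertPerm_spec {P : Type} (f : Equiv.Perm P) {l r : P} (hlr : l ≠ r) :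
    (∀ p : P, ∃ k : ℕ, (insertPerm f l r ^ (k + 1)) (insertPt l r p) = insertPt l r (f p) ∧
      ∀ j < k, (insertPerm f l r ^ (j + 1)) (insertPt l r p) ∉ Set.range (insertPt l r)) ∧
    ∀ q, ∃ k : ℕ, (insertPerm f l r ^ k) q ∈ Set.range (insertPt l r) := by
  classical
  have hT : ∀ y, insertPerm f l r y = Equiv.sumCongr f (Equiv.refl Bool)
      (Equiv.swap (Sum.inl l) (Sum.inr false) (Equiv.swap (Sum.inr true) (Sum.inl r) y)) := by
    intro y
    simp only [insertPerm, Equiv.Perm.mul_apply]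
  have hTl : insertPerm f l r (Sum.inl l) = Sum.inr false := by
    rw [hT, Equiv.swap_apply_of_ne_of_ne (a := (Sum.inr true : P ⊕ Bool)) (by simp)
      (by simpa using hlr)]
    simp
  have hTr : insertPerm f l r (Sum.inl r) = Sum.inr true := by
    rw [hT, Equiv.swap_apply_right, Equiv.swap_apply_of_ne_of_ne (by simp) (by simp)]
    simp
  have hTp : ∀ p, insertPerm f l r (insertPt l r p) = Sum.inl (f p) := by
    intro p
    rw [hT]
    by_cases h1 : p = l
    · simp only [insertPt, h1, if_true]
      rw [Equiv.swap_apply_of_ne_of_ne (a := (Sum.inr true : P ⊕ Bool)) (by simp) (by simp)]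
      simp
    · by_cases h2 : p = r
      · simp only [insertPt, h2, if_true, hlr.symm, if_false]
        rw [Equiv.swap_apply_left, Equiv.swap_apply_of_ne_of_ne (by simpa using hlr.symm) (by simp)]
        simp
      · simp only [insertPt, h1, h2, if_false]
        rw [Equiv.swap_apply_of_ne_of_ne (a := (Sum.inr true : P ⊕ Bool)) (by simp)
          (by simpa using h2), Equiv.swap_apply_of_ne_of_ne (by simpa using h1) (by simp)]
        simp
  have hrl : (Sum.inl l : P ⊕ Bool) ∉ Set.range (insertPt l r) := by
    rintro ⟨a, ha⟩
    simp only [insertPt] at ha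
    split_ifs at ha with h1 h2
    · exact h1 (by simpa using ha)
  have hrr : (Sum.inl r : P ⊕ Bool) ∉ Set.range (insertPt l r) := by
    rintro ⟨a, ha⟩
    simp only [insertPt] at ha
    split_ifs at ha with h1 h2
    · exact h2 (by simpa using ha)
  refine ⟨fun p => ?_, ?_⟩
  · by_cases h1 : f p = l
    · refine ⟨1, ?_, ?_⟩
      · rw [pow_succ, pow_one, Equiv.Perm.mul_apply, hTp, h1, hTl]
        simp [insertPt]
      · intro j hj
        obtain rfl : j = 0 := by omega
        rw [zero_add, pow_one, hTp, h1]
        exact hrl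
    · by_cases h2 : f p = r
      · refine ⟨1, ?_, ?_⟩
        · rw [pow_succ, pow_one, Equiv.Perm.mul_apply, hTp, h2, hTr]
          simp [insertPt, hlr.symm]
        · intro j hj
          obtain rfl : j = 0 := by omega
          rw [zero_add, pow_one, hTp, h2]
          exact hrr
      · refine ⟨0, ?_, by simp⟩
        rw [zero_add, pow_one, hTp]
        simp [insertPt, h1, h2]
  · rintro (q | b)
    · by_cases h1 : q = l
      · exact ⟨1, l, by rw [pow_one, h1, hTl]; simp [insertPt]⟩
      · by_cases h2 : q = r
        · exact ⟨1, r, by rw [pow_one, h2, hTr]; simp [insertPt, hlr.symm]⟩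
        · exact ⟨0, q, by simp [insertPt, h1, h2]⟩
    · cases b
      · exact ⟨0, l, by simp [insertPt]⟩
      · exact ⟨0, r, by simp [insertPt, hlr.symm]⟩

theorem nonempty_thinning_forget (D : LinkDiagram) (c : D.Cr) :
    Nonempty (Thinning ((D.forget c).twistGlue (D.port (c, false)) (D.port (c, true))
      (D.pos c) false) D) := by
  classical
  have hlr : D.port (c, false) ≠ D.port (c, true) := fun h => by simpa using D.port.injective h
  have hnext : ((D.forget c).twistGlue (D.port (c, false)) (D.port (c, true))
      (D.pos c) false).next = insertPerm D.next (D.port (c, false)) (D.port (c, true)) := by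
    have key : ∀ (i j k : DecidableEq (D.Pt ⊕ Bool)) (e : Equiv.Perm (D.Pt ⊕ Bool))
        (u v w z : D.Pt ⊕ Bool),
        (e * @Equiv.swap _ i u v) * @Equiv.swap _ j w z =
          (e * @Equiv.swap _ i u v) * @Equiv.swap _ k w z := by
      intro i j k e u v w z
      rw [Subsingleton.elim j k]
    exact key _ _ _ _ _ _ _ _
  have hspec := insertPerm_spec D.next hlr
  rw [← hnext] at hspec
  let cr : D.Cr → Option {c' : D.Cr // c' ≠ c} := fun a => if h : a = c then none else some ⟨a, h⟩
  have hcr : Function.Bijective cr := by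
    constructor
    · intro a b hab
      by_cases ha : a = c <;> by_cases hb : b = c <;> simp_all [cr]
    · rintro (_ | a)
      · exact ⟨c, by simp [cr]⟩
      · exact ⟨a.1, by have := a.2; simp [cr, this]⟩
  refine ⟨⟨insertPt (D.port (c, false)) (D.port (c, true)), Equiv.ofBijective cr hcr,
    insertPt_injective _ _, ?_, ?_, hspec.1, hspec.2⟩⟩
  · intro a b
    by_cases ha : a = c
    · subst ha
      have h2 : cr a = none := by simp [cr]
      have h3 : insertPt (D.port (a, false)) (D.port (a, true)) (D.port (a, b)) = Sum.inr b := by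
        cases b <;> simp [insertPt]
      change insertPt (D.port (a, false)) (D.port (a, true)) (D.port (a, b)) =
        ((D.forget a).kink (D.port (a, false)) (D.pos a) false).port (cr a, b)
      rw [h2, h3]
      rfl
    · have h2 : cr a = some ⟨a, ha⟩ := by simp [cr, ha]
      have h3 : insertPt (D.port (c, false)) (D.port (c, true)) (D.port (a, b)) =
          Sum.inl (D.port (a, b)) := by
        simp [insertPt, ha]
      change insertPt (D.port (c, false)) (D.port (c, true)) (D.port (a, b)) =
        ((D.forget c).kink (D.port (c, false)) (D.pos c) false).port (cr a, b)
      rw [h2, h3]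
      rfl
  · intro a
    change D.pos a = (cr a).elim (D.pos c) (fun a => D.pos a.1)
    by_cases ha : a = c <;> simp [cr, ha]

theorem card_forget (D : LinkDiagram) (c : D.Cr) :
    Nat.card (D.forget c).Cr + 1 = Nat.card D.Cr := by
  classical
  have := Fintype.ofFinite D.Cr
  have : Nat.card {c' : D.Cr // c' ≠ c} = Nat.card D.Cr - 1 := by simp
  have h0 : 0 < Nat.card D.Cr := Nat.card_pos_iff.mpr ⟨⟨c⟩, inferInstance⟩
  change Nat.card {c' : D.Cr // c' ≠ c} + 1 = _
  omega

theorem nonempty_negative : ∀ (n : ℕ) (D : LinkDiagram), (∀ c, D.pos c = false) →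
    Nat.card D.Cr = n → Nonempty (Film .negative D) := by
  intro n
  induction n with
  | zero =>
    intro D _ hn
    have hC : IsEmpty D.Cr := by
      rcases Nat.card_eq_zero.mp hn with h | h
      · exact h
      · exact absurd D.finCr (not_finite_iff_infinite.mpr h)
    obtain ⟨m⟩ := nonempty_births _ D hC rfl
    exact ⟨m.beginNegative⟩
  | succ n ih =>
    intro D hD hn
    have hne : Nonempty D.Cr := by
      by_contra h
      rw [not_nonempty_iff] at h
      simp at hn
    obtain ⟨c⟩ := hne
    obtain ⟨m⟩ := ih (D.forget c) (fun a => hD a.1) (by have := D.card_forget c; omega)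
    obtain ⟨t⟩ := D.nonempty_thinning_forget c
    rw [hD c] at t
    exact ⟨(m.negativeTwistGlue _ _ _).thin t⟩

/-- Every diagram is the last frame of a movie of Seifert's algorithm. -/
theorem nonempty_seifertMovie (D : LinkDiagram) : Nonempty D.SeifertMovie := by
  induction hn : Nat.card D.Cr generalizing D with
  | zero =>
    have hC : IsEmpty D.Cr := by
      rcases Nat.card_eq_zero.mp hn with h | h
      · exact h
      · exact absurd D.finCr (not_finite_iff_infinite.mpr h)
    obtain ⟨m⟩ := nonempty_negative _ D (fun c => hC.elim c) rfl
    exact ⟨m.beginPositive⟩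
  | succ n ih =>
    by_cases hneg : ∀ c, D.pos c = false
    · obtain ⟨m⟩ := nonempty_negative _ D hneg rfl
      exact ⟨m.beginPositive⟩
    · push Not at hneg
      obtain ⟨c, hc⟩ := hneg
      have hc' : D.pos c = true := by simpa using hc
      obtain ⟨m⟩ := ih (D.forget c) (by have := D.card_forget c; omega)
      obtain ⟨t⟩ := D.nonempty_thinning_forget c
      rw [hc'] at t
      exact ⟨(m.positiveTwistGlue _ _ _).thin t⟩

end LinkDiagram

/-! ### Orthogonal complements of ranges -/

/-! The labellings of the Seifert circles form a basis of the tensor power of `ℤ[X]/(X²)` indexed by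
these circles. A labelling corresponds to the square-free monomial whose variables are the circles
labelled `x`, so a chain on the oriented smoothing is a polynomial modulo the squares of the
variables. In this language every move is a simple operation. A birth adds a variable that does not
occur. A negative twist-and-glue puts `1` on the small circle and then multiplies by it, so nothing
changes. A positive one sends `a` to `a ⊗ x - (x a) ⊗ 1` and then merges the small circle with the
circle of `q`, which is multiplication by `X_q - X_p`. Hence the cycle of any movie is, up to sign,
the product of `X_right - X_left` over the positive crossings, read off at square-free monomials
(`Film.isSeifertChain`).

The rest is about this product. It factors over the components of `Γ₀`, whose variables are disjoint
(`coeff_squareFree_prod`, `seifertPoly_eq_prod_components`). For a connected multigraph with vertex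
set `V` and edge set `E` the product is homogeneous of degree `|E|`, and `b¹ = |E| - |V| + 1`. If
`b¹ ≥ 2`, the degree exceeds `|V|` and no square-free monomial survives. If `b¹ = 0`, the graph is a
tree. The coefficient of the monomial that omits `v` is `±1`, and its sign changes when `v` moves
along an edge. If `b¹ = 1`, one more edge is added to a spanning tree, and the coefficient of the
full monomial is the difference of the tree coefficients that omit its two ends; these have opposite
signs, so it is `±2` (`coeff_edgePoly_connected`).

That the two ends of the extra edge have opposite signs requires `Γ₀` to be bipartite, and here
planarity enters. Euler's formula and a dimension count over `ZMod 2` produce a mod 2 Alexander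
numbering of the regions (`Planar.exists_numbering`); the number on the right of a Seifert circle is
constant along it and differs for two circles that meet at a crossing (`Planar.exists_coloring`). -/

/-- The vectors that are orthogonal to the range of `T`. -/
noncomputable def rangePerp {F m n : Type*} [Field F] [Fintype m] [Fintype n] [DecidableEq n]
    (T : (n → F) →ₗ[F] (m → F)) : Submodule F (m → F) :=
  LinearMap.ker (LinearMap.toMatrix' T).transpose.mulVecLin

theorem mem_rangePerp {F m n : Type*} [Field F] [Fintype m] [Fintype n] [DecidableEq n]
    {T : (n → F) →ₗ[F] (m → F)} {w : m → F} :
    w ∈ rangePerp T ↔ ∀ f, T f ⬝ᵥ w = 0 := by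
  rw [rangePerp, LinearMap.mem_ker, Matrix.mulVecLin_apply]
  have key : ∀ f, T f ⬝ᵥ w = f ⬝ᵥ ((LinearMap.toMatrix' T).transpose.mulVec w) := by
    intro f
    rw [Matrix.mulVec_transpose, dotProduct_comm f, ← Matrix.dotProduct_mulVec, dotProduct_comm,
      LinearMap.toMatrix'_mulVec]
  constructor
  · intro h f
    rw [key, h, dotProduct_zero]
  · intro h
    refine dotProduct_eq_zero _ fun f => ?_
    rw [dotProduct_comm, ← key, h]

/-- A matrix and its transpose have the same rank; combine this with rank-nullity for both. -/
theorem finrank_rangePerp {F m n : Type*} [Field F] [Fintype m] [Fintype n] [DecidableEq n]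
    (T : (n → F) →ₗ[F] (m → F)) :
    Module.finrank F (rangePerp T) + Fintype.card n =
      Fintype.card m + Module.finrank F (LinearMap.ker T) := by
  classical
  have h1 := LinearMap.finrank_range_add_finrank_ker (LinearMap.toMatrix' T).transpose.mulVecLin
  have h2 := LinearMap.finrank_range_add_finrank_ker T
  have h3 := Matrix.rank_transpose (LinearMap.toMatrix' T)
  have h4 : (LinearMap.toMatrix' T).mulVecLin = T := by
    rw [← Matrix.toLin'_apply', Matrix.toLin'_toMatrix']
  rw [Matrix.rank, Matrix.rank, h4] at h3
  rw [Module.finrank_fintype_fun_eq_card] at h1 h2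
  rw [rangePerp]
  omega

/-- An exactness criterion by counting dimensions: the range of `δ` lies in the orthogonal
complement of the range of `T`, and `hcard` makes its dimension at least as large. Upper bounds on
the two kernels are enough to apply it. -/
theorem mem_range_of_orthogonal {F k m n : Type*} [Field F] [Fintype k] [Fintype m] [Fintype n]
    [DecidableEq n] (T : (n → F) →ₗ[F] (m → F)) (δ : (k → F) →ₗ[F] (m → F))
    (h : ∀ f g, T f ⬝ᵥ δ g = 0)
    (hcard : Fintype.card m + Module.finrank F (LinearMap.ker T) +
      Module.finrank F (LinearMap.ker δ) ≤ Fintype.card n + Fintype.card k)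
    {w : m → F} (hw : ∀ f, T f ⬝ᵥ w = 0) : ∃ g, δ g = w := by
  have hle : LinearMap.range δ ≤ rangePerp T := by
    rintro _ ⟨g, rfl⟩
    exact mem_rangePerp.mpr fun f => h f g
  have h1 := finrank_rangePerp T
  have h2 := LinearMap.finrank_range_add_finrank_ker δ
  rw [Module.finrank_fintype_fun_eq_card] at h2
  have h3 := Submodule.eq_of_le_of_finrank_le hle (by omega)
  have h4 : w ∈ LinearMap.range δ := h3 ▸ mem_rangePerp.mpr hw
  exact h4

/-! ### Square-free coefficients of products of differences of variables -/

open MvPolynomial in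
theorem MvPolynomial.support_subset_of_mem_supported {α : Type*} {s : Set α}
    {P : MvPolynomial α ℤ} (hP : P ∈ supported ℤ s) {d : α →₀ ℕ} (hd : P.coeff d ≠ 0) :
    (d.support : Set α) ⊆ s := by
  intro v hv
  rw [mem_supported] at hP
  exact hP ((mem_vars_iff_mem_support v).mpr ⟨d, mem_support_iff.mpr hd, hv⟩)

/-- The exponent of the square-free monomial `∏ v ∈ M, X v`. -/
noncomputable def squareFree {α : Type*} (M : Finset α) : α →₀ ℕ := Finsupp.indicator M fun _ _ => 1

open Classical in
theorem squareFree_apply {α : Type*} (M : Finset α) (v : α) :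
    squareFree M v = if v ∈ M then 1 else 0 := by
  rw [squareFree, Finsupp.indicator_apply]
  split_ifs <;> rfl

theorem support_squareFree {α : Type*} (M : Finset α) : (squareFree M).support = M := by
  ext v
  simp [squareFree_apply]

theorem degree_squareFree {α : Type*} (M : Finset α) : (squareFree M).degree = M.card := by
  rw [Finsupp.degree_apply, support_squareFree, Finset.card_eq_sum_ones]
  exact Finset.sum_congr rfl fun v hv => by simp [squareFree_apply, hv]

open Classical in
theorem squareFree_sub_single {α : Type*} (M : Finset α) (v : α) :
    squareFree M - Finsupp.single v 1 = squareFree (M.erase v) := by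
  ext w
  simp only [Finsupp.tsub_apply, squareFree_apply, Finset.mem_erase, Finsupp.single_apply]
  by_cases h : v = w
  · subst h
    by_cases hv : v ∈ M <;> simp [hv]
  · simp [h, Ne.symm h]

-- The square-free coefficients of `X v * P` depend only on the square-free coefficients of `P`.
-- This is why ordinary polynomials can stand for elements of the quotient by the squares of the
-- variables.
open Classical in
theorem coeff_squareFree_X_mul {α : Type*} (M : Finset α) (v : α) (P : MvPolynomial α ℤ) :
    (MvPolynomial.X v * P).coeff (squareFree M) =
      if v ∈ M then P.coeff (squareFree (M.erase v)) else 0 := by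
  rw [MvPolynomial.coeff_X_mul', support_squareFree, squareFree_sub_single]

open Classical in
theorem coeff_squareFree_rename {α β : Type*} [Fintype α] {f : α → β} (hf : Function.Injective f)
    (M : Finset β) (P : MvPolynomial α ℤ) :
    (MvPolynomial.rename f P).coeff (squareFree M) =
      if ∀ b ∈ M, b ∈ Set.range f then P.coeff (squareFree (Finset.univ.filter fun a => f a ∈ M))
      else 0 := by
  split_ifs with h
  · rw [← MvPolynomial.coeff_rename_mapDomain f hf]
    congr 1
    ext b
    by_cases hb : b ∈ Set.range f
    · obtain ⟨a, rfl⟩ := hb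
      rw [Finsupp.mapDomain_apply hf]
      simp [squareFree_apply]
    · rw [Finsupp.mapDomain_of_notMem_range _ _ hb, squareFree_apply, if_neg fun hM => hb (h b hM)]
  · refine MvPolynomial.coeff_rename_eq_zero _ _ _ fun u hu => absurd ?_ h
    intro b hb
    by_contra hr
    have := Finsupp.mapDomain_of_notMem_range u b hr
    rw [hu, squareFree_apply, if_pos hb] at this
    exact one_ne_zero this

open Classical in
/-- Coefficients of a product of polynomials in disjoint sets of variables. -/
theorem coeff_squareFree_prod {α ι : Type*} (P : ι → MvPolynomial α ℤ) (V : ι → Finset α)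
    (hP : ∀ i, P i ∈ MvPolynomial.supported ℤ (V i : Set α))
    (hV : ∀ i j, i ≠ j → Disjoint (V i) (V j)) (I : Finset ι) (M : Finset α) :
    (∏ i ∈ I, P i).coeff (squareFree M) =
      if M ⊆ I.biUnion V then ∏ i ∈ I, (P i).coeff (squareFree (M ∩ V i)) else 0 := by
  induction I using Finset.induction_on generalizing M with
  | empty =>
    rw [Finset.prod_empty, Finset.prod_empty, MvPolynomial.coeff_one]
    refine if_congr ?_ rfl rfl
    rw [eq_comm, ← Finsupp.support_eq_empty, support_squareFree, Finset.biUnion_empty,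
      Finset.subset_empty]
  | insert i I hi ih =>
    have hmem : ∏ j ∈ I, P j ∈ MvPolynomial.supported ℤ ((I.biUnion V : Finset α) : Set α) := by
      refine Subalgebra.prod_mem _ fun j hj => ?_
      refine MvPolynomial.supported_mono ?_ (hP j)
      exact_mod_cast Finset.subset_biUnion_of_mem V hj
    have hdisj : Disjoint (V i) (I.biUnion V) := by
      rw [Finset.disjoint_biUnion_right]
      exact fun j hj => hV i j fun h => hi (h ▸ hj)
    -- The two factors have disjoint variables, so a nonzero term can only split the exponent into
    -- its part on `V i` and its part off `V i`.
    rw [Finset.prod_insert hi, Finset.prod_insert hi, MvPolynomial.coeff_mul,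
      Finset.sum_eq_single (squareFree (M ∩ V i), squareFree (M \ V i))]
    · rw [ih]
      have h1 : M \ V i ⊆ I.biUnion V ↔ M ⊆ (insert i I).biUnion V := by
        rw [Finset.biUnion_insert]
        exact sdiff_le_iff
      simp only [h1]
      split_ifs
      · congr 1
        refine Finset.prod_congr rfl fun j hj => ?_
        have h2 := hV i j fun h => hi (h ▸ hj)
        have h3 : (M \ V i) ∩ V j = M ∩ V j := by
          ext v
          simp only [Finset.mem_inter, Finset.mem_sdiff]
          exact ⟨fun h => ⟨h.1.1, h.2⟩, fun h => ⟨⟨h.1, Finset.disjoint_right.mp h2 h.2⟩, h.2⟩⟩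
        rw [h3]
      · rw [mul_zero]
    · rintro ⟨a, b⟩ hab hne
      by_contra hcoeff
      rw [Finset.HasAntidiagonal.mem_antidiagonal] at hab
      have ha := MvPolynomial.support_subset_of_mem_supported (hP i) (left_ne_zero_of_mul hcoeff)
      have hb := MvPolynomial.support_subset_of_mem_supported hmem (right_ne_zero_of_mul hcoeff)
      refine hne ?_
      have h0 : ∀ v, a v + b v = if v ∈ M then 1 else 0 := fun v => by
        rw [← squareFree_apply, ← hab, Finsupp.add_apply]
      have ha' : ∀ v, v ∉ V i → a v = 0 := fun v hv => by
        by_contra h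
        exact hv (by exact_mod_cast ha (Finsupp.mem_support_iff.mpr h))
      have hb' : ∀ v, v ∈ V i → b v = 0 := fun v hv => by
        by_contra h
        exact Finset.disjoint_left.mp hdisj hv
          (by exact_mod_cast hb (Finsupp.mem_support_iff.mpr h))
      simp only [Prod.mk.injEq]
      constructor <;> ext v <;> have := h0 v <;> by_cases hv : v ∈ V i <;>
        simp [squareFree_apply, hv, ha', hb'] at this ⊢ <;> simpa [hv, ha', hb'] using this
    · intro h
      refine absurd ?_ h
      rw [Finset.HasAntidiagonal.mem_antidiagonal]
      ext v
      by_cases hv : v ∈ V i <;> simp [squareFree_apply, hv]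

/-! ### Edge polynomials of connected multigraphs. -/

section Multigraph

variable {α C : Type*} (s t : C → α)

/-- The product of the differences of the variables at the two ends of the edges in `E`. -/
noncomputable def edgePoly (E : Finset C) : MvPolynomial α ℤ :=
  ∏ c ∈ E, (MvPolynomial.X (t c) - MvPolynomial.X (s c))

theorem edgePoly_mem_supported {E : Finset C} {V : Set α} (hs : ∀ c ∈ E, s c ∈ V)
    (ht : ∀ c ∈ E, t c ∈ V) : edgePoly s t E ∈ MvPolynomial.supported ℤ V :=
  Subalgebra.prod_mem _ fun c hc => Subalgebra.sub_mem _
    (MvPolynomial.X_mem_supported.mpr (ht c hc)) (MvPolynomial.X_mem_supported.mpr (hs c hc))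

/-- The edge polynomial is homogeneous, of degree the number of edges. -/
theorem coeff_edgePoly_eq_zero {E : Finset C} {M : Finset α} (h : M.card ≠ E.card) :
    (edgePoly s t E).coeff (squareFree M) = 0 := by
  have hom : (edgePoly s t E).IsHomogeneous (∑ _c ∈ E, 1) :=
    MvPolynomial.IsHomogeneous.prod _ _ _ fun c _ =>
      (MvPolynomial.isHomogeneous_X ℤ _).sub (MvPolynomial.isHomogeneous_X ℤ _)
  refine hom.coeff_eq_zero ?_
  rwa [degree_squareFree, ← Finset.card_eq_sum_ones]

open Classical in
theorem coeff_squareFree_edge_mul (c : C) (M : Finset α) (P : MvPolynomial α ℤ) :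
    ((MvPolynomial.X (t c) - MvPolynomial.X (s c)) * P).coeff (squareFree M) =
      (if t c ∈ M then P.coeff (squareFree (M.erase (t c))) else 0) -
      if s c ∈ M then P.coeff (squareFree (M.erase (s c))) else 0 := by
  rw [sub_mul, MvPolynomial.coeff_sub, coeff_squareFree_X_mul, coeff_squareFree_X_mul]

variable {s t}

open Classical in
/-- Spanning trees exist, and their edge polynomials have the coefficients `±1`. -/
theorem exists_spanning_tree {χ : α → ℤˣ} {E : Finset C} {V : Finset α} (hV : V.Nonempty)
    (hχ : ∀ c ∈ E, χ (t c) = -χ (s c)) (hs : ∀ c ∈ E, s c ∈ V) (ht : ∀ c ∈ E, t c ∈ V)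
    (hconn : ∀ p : α → Prop, (∀ c ∈ E, p (s c) ↔ p (t c)) → ∀ v ∈ V, ∀ w ∈ V, p v → p w) :
    ∃ T ⊆ E, T.card + 1 = V.card ∧
      ∃ ε : ℤˣ, ∀ v ∈ V, (edgePoly s t T).coeff (squareFree (V.erase v)) = ε * χ v := by
  -- A tree `T` with vertex set `S` is grown one edge at a time, together with the signs of its
  -- coefficients.
  have grow : ∀ n < V.card, ∃ T ⊆ E, ∃ S ⊆ V, T.card = n ∧ S.card = n + 1 ∧
      (∀ c ∈ T, s c ∈ S) ∧ (∀ c ∈ T, t c ∈ S) ∧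
      ∃ ε : ℤˣ, ∀ v ∈ S, (edgePoly s t T).coeff (squareFree (S.erase v)) = ε * χ v := by
    intro n
    induction n with
    | zero =>
      intro _
      obtain ⟨v, hv⟩ := hV
      -- The empty product has coefficient `1 = χ v * χ v`, whence the sign `χ v`.
      refine ⟨∅, by simp, {v}, by simpa using hv, by simp, by simp, by simp, by simp, χ v, ?_⟩
      intro w hw
      obtain rfl : w = v := by simpa using hw
      have h0 : squareFree (∅ : Finset α) = 0 := by
        rw [← Finsupp.support_eq_empty, support_squareFree]
      have h1 : ((χ w : ℤ)) * χ w = 1 := by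
        rw [← Units.val_mul, Int.units_mul_self, Units.val_one]
      simp [edgePoly, h0, h1]
    | succ n ih =>
      intro hn
      obtain ⟨T, hTE, S, hSV, hT, hS, hsS, htS, ε, hε⟩ := ih (by omega)
      obtain ⟨c, hc, hcS⟩ : ∃ c ∈ E, ¬ (s c ∈ S ↔ t c ∈ S) := by
        -- If no edge left `S`, membership in `S` would spread to all of `V`, which is larger than
        -- `S`.
        by_contra! h
        obtain ⟨v, hv⟩ : S.Nonempty := Finset.card_pos.mp (by omega)
        have := Finset.card_le_card
          (fun w hw => hconn (· ∈ S) h v (hSV hv) w hw hv : V ⊆ S)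
        omega
      have hcT : c ∉ T := fun h => hcS ⟨fun _ => htS c h, fun _ => hsS c h⟩
      have hzero : ∀ M : Finset α, ¬ M ⊆ S → (edgePoly s t T).coeff (squareFree M) = 0 := by
        intro M hM
        by_contra h
        have := MvPolynomial.support_subset_of_mem_supported
          (edgePoly_mem_supported s t (V := (S : Set α)) (by simpa using hsS) (by simpa using htS)) h
        rw [support_squareFree] at this
        exact hM (by exact_mod_cast this)
      have hpoly : edgePoly s t (insert c T) =
          (MvPolynomial.X (t c) - MvPolynomial.X (s c)) * edgePoly s t T :=
        Finset.prod_insert hcT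
      -- `w` is the new vertex, and `u` is the old one
      have main : ∀ u w : α, u ∈ S → w ∉ S → χ w = -χ u → w ∈ V →
          (s c ∈ insert w S) → (t c ∈ insert w S) →
          (∃ η : ℤˣ, ∀ M : Finset α, (edgePoly s t (insert c T)).coeff (squareFree M) =
            η * ((if w ∈ M then (edgePoly s t T).coeff (squareFree (M.erase w)) else 0) -
              if u ∈ M then (edgePoly s t T).coeff (squareFree (M.erase u)) else 0)) →
          ∃ T ⊆ E, ∃ S ⊆ V, T.card = n + 1 ∧ S.card = n + 1 + 1 ∧
            (∀ c ∈ T, s c ∈ S) ∧ (∀ c ∈ T, t c ∈ S) ∧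
            ∃ ε : ℤˣ, ∀ v ∈ S,
              (edgePoly s t T).coeff (squareFree (S.erase v)) = ε * χ v := by
        -- The sign `η` records whether the new edge is directed towards `w` or away from it.
        rintro u w hu hw hχw hwV hsc htc ⟨η, hη⟩
        refine ⟨insert c T, Finset.insert_subset hc hTE, insert w S, Finset.insert_subset hwV hSV,
          by rw [Finset.card_insert_of_notMem hcT, hT],
          by rw [Finset.card_insert_of_notMem hw, hS], ?_, ?_, η * ε, ?_⟩
        · intro e he
          rcases Finset.mem_insert.mp he with rfl | he
          · exact hsc
          · exact Finset.mem_insert_of_mem (hsS e he)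
        · intro e he
          rcases Finset.mem_insert.mp he with rfl | he
          · exact htc
          · exact Finset.mem_insert_of_mem (htS e he)
        · intro v hv
          have huw : u ≠ w := fun h => hw (h ▸ hu)
          rw [hη]
          by_cases hvw : v = w
          · subst hvw
            -- When the new vertex is the omitted one, only the term of `X u` contributes, and its
            -- minus sign turns `χ u` into `χ w`.
            rw [Finset.erase_insert hw, if_neg hw, if_pos hu, hε u hu, hχw]
            push_cast
            ring
          · have hvS : v ∈ S := (Finset.mem_insert.mp hv).resolve_left hvw
            have h1 : (insert w S).erase v = insert w (S.erase v) :=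
              Finset.erase_insert_of_ne (Ne.symm hvw)
            have h2 : w ∉ S.erase v := fun h => hw (Finset.mem_of_mem_erase h)
            -- When an old vertex is omitted, only the term of `X w` contributes: the term of `X u`
            -- would need a monomial of the old tree that contains `w`.
            rw [h1, if_pos (Finset.mem_insert_self _ _), Finset.erase_insert h2, hε v hvS,
              hzero ((insert w (S.erase v)).erase u)]
            · push_cast
              simp [mul_assoc]
            · intro h
              exact hw (h (Finset.mem_erase.mpr ⟨huw.symm, Finset.mem_insert_self _ _⟩))
      by_cases hsc : s c ∈ S
      · have htc : t c ∉ S := fun h => hcS ⟨fun _ => h, fun _ => hsc⟩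
        refine main (s c) (t c) hsc htc (hχ c hc) (ht c hc) (Finset.mem_insert_of_mem hsc)
          (Finset.mem_insert_self _ _) ⟨1, fun M => ?_⟩
        rw [hpoly, coeff_squareFree_edge_mul, Units.val_one, one_mul]
      · have htc : t c ∈ S := by
          by_contra h
          exact hcS ⟨fun h' => absurd h' hsc, fun h' => absurd h' h⟩
        refine main (t c) (s c) htc hsc (by rw [hχ c hc, neg_neg]) (hs c hc)
          (Finset.mem_insert_self _ _) (Finset.mem_insert_of_mem htc) ⟨-1, fun M => ?_⟩
        rw [hpoly, coeff_squareFree_edge_mul]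
        push_cast
        ring
  have hpos := Finset.card_pos.mpr hV
  obtain ⟨T, hTE, S, hSV, hT, hS, -, -, ε, hε⟩ := grow (V.card - 1) (by omega)
  obtain rfl : S = V := Finset.eq_of_subset_of_card_le hSV (by omega)
  exact ⟨T, hTE, by omega, ε, hε⟩

open Classical in
/-- The square-free coefficients of the edge polynomial of a connected multigraph with a proper
2-colouring. -/
theorem coeff_edgePoly_connected {χ : α → ℤˣ} {E : Finset C} {V : Finset α} (hV : V.Nonempty)
    (hχ : ∀ c ∈ E, χ (t c) = -χ (s c)) (hs : ∀ c ∈ E, s c ∈ V) (ht : ∀ c ∈ E, t c ∈ V)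
    (hconn : ∀ p : α → Prop, (∀ c ∈ E, p (s c) ↔ p (t c)) → ∀ v ∈ V, ∀ w ∈ V, p v → p w) :
    ∃ ε : ℤˣ, ∀ M ⊆ V, (edgePoly s t E).coeff (squareFree M) =
      ε * if E.card + 1 = V.card then ∑ v ∈ V, if M = V.erase v then (χ v : ℤ) else 0
        else if E.card = V.card then if M = V then 2 else 0
        else 0 := by
  obtain ⟨T, hTE, hT, ε, hε⟩ := exists_spanning_tree hV hχ hs ht hconn
  by_cases h0 : E.card + 1 = V.card
  -- The graph is a tree, hence equal to its spanning tree.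
  · obtain rfl : T = E := Finset.eq_of_subset_of_card_le hTE (by omega)
    refine ⟨ε, fun M hM => ?_⟩
    rw [if_pos h0]
    by_cases hMv : ∃ v ∈ V, M = V.erase v
    · obtain ⟨v, hv, rfl⟩ := hMv
      rw [hε v hv, Finset.sum_eq_single v, if_pos rfl]
      · intro w hw hwv
        refine if_neg fun h => ?_
        have : w ∈ V.erase v := Finset.mem_erase.mpr ⟨hwv, hw⟩
        rw [h] at this
        simp at this
      · exact fun h => absurd hv h
    · rw [coeff_edgePoly_eq_zero, Finset.sum_eq_zero, mul_zero]
      · exact fun v hv => if_neg fun h => hMv ⟨v, hv, h⟩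
      · intro hcard
        obtain ⟨v, hv, rfl⟩ := (Finset.covBy_iff_exists_insert (s := M) (t := V)).mp
          (Finset.covBy_iff_card_sdiff_eq_one.mpr
            ⟨hM, by rw [Finset.card_sdiff_of_subset hM]; omega⟩)
        exact hMv ⟨v, Finset.mem_insert_self _ _, (Finset.erase_insert hv).symm⟩
  · by_cases h1 : E.card = V.card
    · obtain ⟨c, hcT, hc⟩ : ∃ c ∉ T, insert c T = E :=
        (Finset.covBy_iff_exists_insert (s := T) (t := E)).mp
          (Finset.covBy_iff_card_sdiff_eq_one.mpr
            ⟨hTE, by rw [Finset.card_sdiff_of_subset hTE]; omega⟩)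
      have hcE : c ∈ E := hc ▸ Finset.mem_insert_self _ _
      -- The extra edge `c` gives `ε * χ (t c) - ε * χ (s c)` on the full monomial. As the ends have
      -- opposite colours, this is `2 * (ε * χ (t c))`.
      refine ⟨ε * χ (t c), fun M hM => ?_⟩
      rw [if_neg h0, if_pos h1]
      by_cases hMV : M = V
      · have hpoly : edgePoly s t E =
            (MvPolynomial.X (t c) - MvPolynomial.X (s c)) * edgePoly s t T := by
          rw [← hc]
          exact Finset.prod_insert hcT
        have h2 : χ (s c) = -χ (t c) := by rw [hχ c hcE, neg_neg]
        rw [if_pos hMV, hMV, hpoly, coeff_squareFree_edge_mul, if_pos (ht c hcE),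
          if_pos (hs c hcE), hε _ (ht c hcE), hε _ (hs c hcE), h2]
        push_cast
        ring
      · rw [if_neg hMV, mul_zero]
        refine coeff_edgePoly_eq_zero s t fun h => hMV ?_
        exact Finset.eq_of_subset_of_card_le hM (by omega)
    -- There are more edges than vertices, so the degree is too large for a square-free monomial in
    -- `V`, and any sign will do.
    · refine ⟨1, fun M hM => ?_⟩
      rw [if_neg h0, if_neg h1, mul_zero]
      refine coeff_edgePoly_eq_zero s t fun h => ?_
      have h2 := Finset.card_le_card hM
      have h3 := Finset.card_le_card hTE
      omega

end Multigraph

/-- The decidability instances are arbitrary, so that conditionals elaborated with different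
instances can be compared, and the values need to agree only where the condition holds. -/
theorem ite_eq_ite_of_iff {α : Sort*} {p q : Prop} {dp : Decidable p} {dq : Decidable q} {a a' b : α}
    (h : p ↔ q) (ha : q → a = a') : (if p then a else b) = if q then a' else b := by
  by_cases hq : q
  · rw [if_pos hq, if_pos (h.mpr hq), ha hq]
  · rw [if_neg hq, if_neg fun hp => hq (h.mp hp)]

namespace LinkDiagram

/-! ### Seifert circles and the edge polynomial of a diagram -/

/-- The Seifert circle that contains the arc `p`. -/
def circle (D : LinkDiagram) (p : D.Pt) : D.Loop D.orientedState := D.loop D.orientedState p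

theorem circle_surjective (D : LinkDiagram) : Function.Surjective D.circle := Quot.exists_rep

theorem circle_next (D : LinkDiagram) (p : D.Pt) : D.circle (D.next p) = D.circle p := by
  by_cases h : D.next p ∈ Set.range D.port
  · obtain ⟨⟨c, b⟩, h⟩ := h
    have := Joins.through (D := D) (σ := D.orientedState) c b rfl
    rw [h, Equiv.symm_apply_apply] at this
    exact (Quot.sound this).symm
  · have := Joins.mark (D := D) (σ := D.orientedState) (D.next p) h
    rw [Equiv.symm_apply_apply] at this
    exact (Quot.sound this).symm

/-- A function on the points that is constant along the strands of the oriented smoothing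
descends to the Seifert circles. -/
def circleLift (D : LinkDiagram) {β : Sort*} (F : D.Pt → β) (hF : ∀ p, F (D.next p) = F p) :
    D.Loop D.orientedState → β :=
  Quot.lift F (by
    have h : ∀ p, F (D.next.symm p) = F p := fun p => by
      rw [← hF (D.next.symm p), Equiv.apply_symm_apply]
    intro a b hab
    cases hab with
    | mark _ _ => exact h _
    | through c b _ => exact h _
    | incoming c h' => exact absurd rfl h'
    | outgoing c h' => exact absurd rfl h')

theorem circleLift_circle (D : LinkDiagram) {β : Sort*} (F : D.Pt → β)
    (hF : ∀ p, F (D.next p) = F p) (p : D.Pt) : D.circleLift F hF (D.circle p) = F p := rfl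

theorem circle_next_pow (D : LinkDiagram) (k : ℕ) (p : D.Pt) :
    D.circle ((D.next ^ k) p) = D.circle p := by
  induction k with
  | zero => rfl
  | succ k ih => rw [pow_succ', Equiv.Perm.mul_apply, circle_next, ih]

/-- The enhanced state on the oriented smoothing with the given labels. -/
abbrev orientedEnhanced (D : LinkDiagram) (l : D.Loop D.orientedState → KhLabel) :
    D.EnhancedState := ⟨D.orientedState, l⟩

theorem label_orientedEnhanced (D : LinkDiagram) (l : D.Loop D.orientedState → KhLabel)
    (p : D.Pt) : label (D.orientedEnhanced l) p = l (D.circle p) := rfl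

theorem gen_self {D : LinkDiagram} (s : D.EnhancedState) : gen s s = 1 := by
  classical
  rw [gen, Pi.single_eq_same]

theorem gen_of_ne {D : LinkDiagram} {s s' : D.EnhancedState} (h : s' ≠ s) : gen s s' = 0 := by
  classical
  rw [gen, Pi.single_eq_of_ne h]

/-- Chains on the oriented smoothing. -/
def OnOriented {D : LinkDiagram} (z : D.Chain) : Prop :=
  ∀ s : D.EnhancedState, s.1 ≠ D.orientedState → z s = 0

theorem ofCoeff_apply {D D' : LinkDiagram} (a : D.EnhancedState → D'.EnhancedState → ℤ)
    (z : D.Chain) (s' : D'.EnhancedState) : ofCoeff a z s' = ∑ s, a s s' * z s := rfl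

noncomputable instance (D : LinkDiagram) (σ : D.State) : Fintype (D.Loop σ → KhLabel) :=
  Fintype.ofFinite _

theorem ofCoeff_apply_of_onOriented {D D' : LinkDiagram}
    (a : D.EnhancedState → D'.EnhancedState → ℤ) {z : D.Chain} (hz : OnOriented z)
    (s' : D'.EnhancedState) :
    ofCoeff a z s' = ∑ l, a (D.orientedEnhanced l) s' * z (D.orientedEnhanced l) := by
  classical
  rw [ofCoeff_apply]
  symm
  refine Finset.sum_of_injOn D.orientedEnhanced ?_ (fun _ _ => Finset.mem_coe.mpr
    (Finset.mem_univ _)) ?_ fun _ _ => rfl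
  · intro l _ l' _ h
    simpa using h
  · rintro ⟨σ, l⟩ _ h
    by_cases hσ : σ = D.orientedState
    · subst hσ
      exact absurd ⟨l, by simp⟩ h
    · rw [hz _ hσ, mul_zero]

/-- Births, changes of markings and negative kinks have this form: the target labelling leaves only
one possible source. -/
theorem ofCoeff_apply_of_unique {D D' : LinkDiagram}
    (a : D.EnhancedState → D'.EnhancedState → ℤ) {z : D.Chain} (hz : OnOriented z)
    (s' : D'.EnhancedState) (l₀ : D.Loop D.orientedState → KhLabel)
    (h : ∀ l, l ≠ l₀ → a (D.orientedEnhanced l) s' = 0) :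
    ofCoeff a z s' = a (D.orientedEnhanced l₀) s' * z (D.orientedEnhanced l₀) := by
  rw [ofCoeff_apply_of_onOriented a hz, Finset.sum_eq_single l₀]
  · intro l _ hl
    rw [h l hl, zero_mul]
  · exact fun h => absurd (Finset.mem_univ _) h

open Classical in
/-- The Seifert circles labelled `x`. -/
noncomputable def xSet {L : Type*} [Fintype L] (l : L → KhLabel) : Finset L :=
  Finset.univ.filter fun v => l v = KhLabel.x

theorem mem_xSet {L : Type*} [Fintype L] {l : L → KhLabel} {v : L} :
    v ∈ xSet l ↔ l v = KhLabel.x := by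
  classical
  simp [xSet]

open Classical in
theorem xSet_update_one {L : Type*} [Fintype L] (l : L → KhLabel) (v : L) :
    xSet (Function.update l v KhLabel.one) = (xSet l).erase v := by
  ext w
  by_cases h : w = v
  · subst h; simp [mem_xSet]
  · simp [mem_xSet, h]

noncomputable instance (D : LinkDiagram) (σ : D.State) : Fintype (D.Loop σ) := Fintype.ofFinite _

noncomputable instance (D : LinkDiagram) : Fintype D.Cr := Fintype.ofFinite _

/-- The positive crossings. -/
noncomputable def posCr (D : LinkDiagram) : Finset D.Cr := Finset.univ.filter fun c => D.pos c = true

/-- The product, over the positive crossings, of the difference of the variables of the two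
Seifert circles that meet there. -/
noncomputable def seifertPoly (D : LinkDiagram) : MvPolynomial (D.Loop D.orientedState) ℤ :=
  edgePoly (fun c => D.circle (D.port (c, false))) (fun c => D.circle (D.port (c, true))) D.posCr

/-- The coefficients of `z` are those of the Seifert polynomial, up to an overall sign. -/
def IsSeifertChain {D : LinkDiagram} (z : D.Chain) : Prop :=
  OnOriented z ∧ ∃ ε : ℤˣ, ∀ l, z (D.orientedEnhanced l) =
    ε * D.seifertPoly.coeff (squareFree (xSet l))

/-! ### The empty diagram and births -/

theorem isSeifertChain_empty : IsSeifertChain (D := LinkDiagram.empty) fun _ => 1 := by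
  have hE : IsEmpty empty.Cr := inferInstanceAs (IsEmpty Empty)
  have hL : IsEmpty (empty.Loop empty.orientedState) :=
    ⟨fun v => by obtain ⟨p, -⟩ := Quot.exists_rep v; exact Empty.elim p⟩
  refine ⟨fun s hs => absurd (Subsingleton.elim _ _) hs, 1, fun l => ?_⟩
  have h1 : empty.seifertPoly = 1 := Finset.prod_eq_one fun c => hE.elim c
  have h2 : squareFree (xSet l) = 0 := Subsingleton.elim _ _
  rw [h1, h2, MvPolynomial.coeff_zero_one, Units.val_one, one_mul]

/-- An inclusion of Seifert circles that is compatible with the positive crossings. -/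
theorem seifertPoly_eq_rename {D D' : LinkDiagram}
    (f : D.Loop D.orientedState → D'.Loop D'.orientedState) (e : D.Cr ≃ D'.Cr)
    (hpos : ∀ c, D'.pos (e c) = D.pos c)
    (hf : ∀ c b, D'.circle (D'.port (e c, b)) = f (D.circle (D.port (c, b)))) :
    D'.seifertPoly = MvPolynomial.rename f D.seifertPoly := by
  rw [seifertPoly, seifertPoly, edgePoly, edgePoly, map_prod]
  symm
  refine Finset.prod_equiv e (fun c => by simp [posCr, hpos]) fun c _ => ?_
  simp [hf]

-- A circle outside the range of `f` has a variable that does not occur in the renamed polynomial,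
-- so a monomial that occurs must label it `1`.
open Classical in
theorem coeff_xSet_rename {L L' : Type*} [Fintype L] [Fintype L'] {f : L → L'}
    (hf : Function.Injective f) (l : L' → KhLabel) (P : MvPolynomial L ℤ) :
    (MvPolynomial.rename f P).coeff (squareFree (xSet l)) =
      if ∀ v ∉ Set.range f, l v = KhLabel.one then P.coeff (squareFree (xSet (l ∘ f))) else 0 := by
  rw [coeff_squareFree_rename hf]
  have h1 : (∀ b ∈ xSet l, b ∈ Set.range f) ↔ ∀ v ∉ Set.range f, l v = KhLabel.one := by
    refine forall_congr' fun v => ?_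
    rw [mem_xSet]
    cases l v <;> simp
  have h2 : (Finset.univ.filter fun a => f a ∈ xSet l) = xSet (l ∘ f) := by
    ext v
    simp [mem_xSet]
  rw [h2]
  simp only [h1]

/-- The inclusion of the Seifert circles in a birth. -/
noncomputable def birthCircle (D : LinkDiagram) :
    D.Loop D.orientedState → D.birth.Loop D.birth.orientedState :=
  D.circleLift (fun p => D.birth.circle (some p)) fun p => D.birth.circle_next (some p)

theorem birthCircle_injective (D : LinkDiagram) : Function.Injective D.birthCircle := by
  intro v w h
  obtain ⟨p, rfl⟩ := D.circle_surjective v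
  obtain ⟨q, rfl⟩ := D.circle_surjective w
  have := congrArg (D.birth.circleLift (fun a => a.map D.circle) (by
    rintro (_ | a)
    · rfl
    · exact congrArg some (D.circle_next a))) h
  exact Option.some.inj this

theorem mem_range_birthCircle (D : LinkDiagram) (v : D.birth.Loop D.birth.orientedState) :
    v ∈ Set.range D.birthCircle ↔ v ≠ D.birth.circle none := by
  constructor
  · rintro ⟨w, rfl⟩ h
    obtain ⟨p, rfl⟩ := D.circle_surjective w
    have := congrArg (D.birth.circleLift (fun a => a.isSome) (by
      rintro (_ | a) <;> rfl)) h
    exact Bool.noConfusion (show true = false from this)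
  · intro h
    obtain ⟨_ | p, rfl⟩ := D.birth.circle_surjective v
    · exact absurd rfl h
    · exact ⟨D.circle p, rfl⟩

/-- The new circle meets no crossing. Its variable is absent from the Seifert polynomial, which
matches its label `1`. -/
theorem isSeifertChain_birthMap {D : LinkDiagram} {z : D.Chain} (hz : IsSeifertChain z) :
    IsSeifertChain (birthMap D z) := by
  classical
  obtain ⟨hz, ε, hε⟩ := hz
  refine ⟨?_, ε, ?_⟩
  · intro s hs
    rw [birthMap, ofCoeff_apply_of_onOriented _ hz]
    refine Finset.sum_eq_zero fun l _ => ?_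
    rw [if_neg, zero_mul]
    exact fun h => hs h.1
  · intro l
    rw [birthMap, ofCoeff_apply_of_unique _ hz _ (l ∘ D.birthCircle), hε,
      seifertPoly_eq_rename (D := D) (D' := D.birth) D.birthCircle (Equiv.refl _) (fun _ => rfl)
        (fun _ _ => rfl), coeff_xSet_rename D.birthCircle_injective]
    · have h1 : (∀ v ∉ Set.range D.birthCircle, l v = KhLabel.one) ↔
          l (D.birth.circle none) = KhLabel.one := by
        simp only [mem_range_birthCircle, not_not, forall_eq]
      have h2 : (D.birth.orientedState = D.orientedState ∧
          (∀ p : D.Pt, label (D.birth.orientedEnhanced l) (some p) =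
            label (D.orientedEnhanced (l ∘ D.birthCircle)) p) ∧
          label (D.birth.orientedEnhanced l) none = KhLabel.one) ↔
          l (D.birth.circle none) = KhLabel.one :=
        ⟨fun h => h.2.2, fun h => ⟨rfl, fun p => rfl, h⟩⟩
      rw [if_congr h1 rfl rfl]
      refine (congrArg (· * _) (if_congr h2 rfl rfl)).trans ?_
      split_ifs <;> simp
    · intro l' hl'
      refine if_neg fun h => hl' ?_
      funext v
      obtain ⟨p, rfl⟩ := D.circle_surjective v
      exact (h.2.1 p).symm

/-! ### Deleting and adding markings -/

namespace Thinning

variable {D D' : LinkDiagram} (t : Thinning D D')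

theorem exists_first_hit (q : D.Pt) : ∃ (p : D'.Pt) (k : ℕ), (D.next ^ k) q = t.pt p ∧
    ∀ j < k, (D.next ^ j) q ∉ Set.range t.pt := by
  classical
  obtain ⟨p, hp⟩ := Nat.find_spec (t.pt_meets q)
  exact ⟨p, _, hp.symm, fun j hj => Nat.find_min (t.pt_meets q) hj⟩

/-- The first marked point that is kept, on the strand that starts with `q`. -/
noncomputable def firstHit (q : D.Pt) : D'.Pt := (t.exists_first_hit q).choose

theorem firstHit_eq {q : D.Pt} {p : D'.Pt} {k : ℕ} (hk : (D.next ^ k) q = t.pt p)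
    (hmin : ∀ j < k, (D.next ^ j) q ∉ Set.range t.pt) : t.firstHit q = p := by
  obtain ⟨k', hk', hmin'⟩ := (t.exists_first_hit q).choose_spec
  rcases lt_trichotomy k k' with h | h | h
  · exact absurd ⟨p, hk.symm⟩ (hmin' k h)
  · subst h
    exact t.pt_injective (hk'.symm.trans hk)
  · exact absurd ⟨_, hk'.symm⟩ (hmin k' h)

/-- If `q` is kept, then the first hit moves on to its successor in `D'`; otherwise `q` and `D.next
q` have the same first hit. -/
theorem circle_firstHit_next (q : D.Pt) :
    D'.circle (t.firstHit (D.next q)) = D'.circle (t.firstHit q) := by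
  by_cases hq : q ∈ Set.range t.pt
  · obtain ⟨p, rfl⟩ := hq
    obtain ⟨k, hk, hmin⟩ := t.pt_next p
    have h1 : t.firstHit (t.pt p) = p :=
      t.firstHit_eq (k := 0) rfl fun j hj => absurd hj (Nat.not_lt_zero j)
    have h2 : t.firstHit (D.next (t.pt p)) = D'.next p :=
      t.firstHit_eq (k := k) (by rw [← hk, pow_succ, Equiv.Perm.mul_apply])
        fun j hj => by rw [← Equiv.Perm.mul_apply, ← pow_succ]; exact hmin j hj
    rw [h1, h2, circle_next]
  · obtain ⟨k, hk, hmin⟩ := (t.exists_first_hit q).choose_spec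
    rcases k with _ | k
    · exact absurd ⟨_, hk.symm⟩ hq
    · congr 1
      exact t.firstHit_eq (k := k) (by rw [← Equiv.Perm.mul_apply, ← pow_succ]; exact hk)
        fun j hj => by rw [← Equiv.Perm.mul_apply, ← pow_succ]; exact hmin _ (by omega)

/-- The Seifert circles do not change when markings are deleted. -/
noncomputable def circleEquiv : D'.Loop D'.orientedState ≃ D.Loop D.orientedState where
  toFun := D'.circleLift (fun p => D.circle (t.pt p)) fun p => by
    obtain ⟨k, hk, -⟩ := t.pt_next p
    rw [← hk, circle_next_pow]
  invFun := D.circleLift (fun q => D'.circle (t.firstHit q)) t.circle_firstHit_next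
  left_inv v := by
    obtain ⟨p, rfl⟩ := D'.circle_surjective v
    rw [circleLift_circle, circleLift_circle]
    congr 1
    exact t.firstHit_eq (k := 0) rfl fun j hj => absurd hj (Nat.not_lt_zero j)
  right_inv v := by
    obtain ⟨q, rfl⟩ := D.circle_surjective v
    rw [circleLift_circle, circleLift_circle]
    obtain ⟨k, hk, -⟩ := (t.exists_first_hit q).choose_spec
    rw [firstHit, ← hk, circle_next_pow]

theorem circleEquiv_circle (p : D'.Pt) : t.circleEquiv (D'.circle p) = D.circle (t.pt p) := rfl

theorem seifertPoly_eq : D.seifertPoly = MvPolynomial.rename t.circleEquiv D'.seifertPoly :=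
  seifertPoly_eq_rename _ t.cr (fun c => (t.pos_cr c).symm) fun c b => by
    rw [circleEquiv_circle, t.pt_port]

theorem coeff_seifertPoly (l : D.Loop D.orientedState → KhLabel) :
    D.seifertPoly.coeff (squareFree (xSet l)) =
      D'.seifertPoly.coeff (squareFree (xSet (l ∘ t.circleEquiv))) := by
  classical
  rw [t.seifertPoly_eq, coeff_xSet_rename t.circleEquiv.injective, if_pos]
  exact fun v hv => absurd (t.circleEquiv.surjective v) hv

theorem orientedState_cr (c : D'.Cr) : D'.orientedState c = D.orientedState (t.cr c) := by
  rw [orientedState, orientedState, t.pos_cr]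

/-- On the oriented smoothing the relation `Same` is the graph of a bijection of labellings, so
`map` and `mapBack` only rename variables. -/
theorem same_iff (l : D.Loop D.orientedState → KhLabel)
    (l' : D'.Loop D'.orientedState → KhLabel) :
    t.Same (D.orientedEnhanced l) (D'.orientedEnhanced l') ↔ l ∘ t.circleEquiv = l' := by
  constructor
  · intro h
    funext v
    obtain ⟨p, rfl⟩ := D'.circle_surjective v
    exact (h.2 p).symm
  · rintro rfl
    exact ⟨t.orientedState_cr, fun p => rfl⟩

theorem isSeifertChain_map {z : D.Chain} (hz : IsSeifertChain z) : IsSeifertChain (t.map z) := by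
  classical
  obtain ⟨hz, ε, hε⟩ := hz
  refine ⟨?_, ε, ?_⟩
  · intro s hs
    rw [map, ofCoeff_apply_of_onOriented _ hz]
    refine Finset.sum_eq_zero fun l _ => ?_
    rw [if_neg, zero_mul]
    exact fun h => hs (funext fun c => (h.1 c).trans (t.orientedState_cr c).symm)
  · intro l
    have h1 : (l ∘ t.circleEquiv.symm) ∘ t.circleEquiv = l := by
      funext v
      simp
    rw [map, ofCoeff_apply_of_unique _ hz _ (l ∘ t.circleEquiv.symm), hε, t.coeff_seifertPoly,
      if_pos ((t.same_iff _ _).mpr h1), one_mul, h1]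
    intro l' hl'
    refine if_neg fun h => hl' ?_
    rw [t.same_iff] at h
    rw [← h]
    funext v
    simp

theorem isSeifertChain_mapBack {z : D'.Chain} (hz : IsSeifertChain z) :
    IsSeifertChain (t.mapBack z) := by
  classical
  obtain ⟨hz, ε, hε⟩ := hz
  refine ⟨?_, ε, ?_⟩
  · intro s hs
    rw [mapBack, ofCoeff_apply_of_onOriented _ hz]
    refine Finset.sum_eq_zero fun l _ => ?_
    rw [if_neg, zero_mul]
    refine fun h => hs (funext fun c => ?_)
    obtain ⟨c, rfl⟩ := t.cr.surjective c
    rw [← t.orientedState_cr]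
    exact (h.1 c).symm
  · intro l
    rw [mapBack, ofCoeff_apply_of_unique _ hz _ (l ∘ t.circleEquiv), hε, t.coeff_seifertPoly,
      if_pos ((t.same_iff _ _).mpr rfl), one_mul]
    exact fun l' hl' => if_neg fun h => hl' ((t.same_iff _ _).mp h).symm

end Thinning

end LinkDiagram

namespace LinkDiagram

/-- The `Fintype` instance is a parameter so that, for a diagram with a new crossing, the instance
of `Option` can be used and the factor of the new crossing split off. -/
theorem seifertPoly_eq_prod (D : LinkDiagram) [Fintype D.Cr] : D.seifertPoly =
    ∏ c : D.Cr, if D.pos c = true then MvPolynomial.X (D.circle (D.port (c, true))) -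
      MvPolynomial.X (D.circle (D.port (c, false))) else 1 := by
  rw [seifertPoly, edgePoly, posCr, Finset.prod_filter]
  refine Finset.prod_congr ?_ fun _ _ => rfl
  ext
  simp

/-! ### Kinks -/

section Kink

variable (D : LinkDiagram) (p : D.Pt) (sgn side : Bool)

theorem kink_next_arc : (D.kink p sgn side).next (Sum.inl p) = Sum.inr side := by
  classical
  exact congrArg (Equiv.sumCongr D.next (Equiv.refl Bool)) (Equiv.swap_apply_left _ _)

theorem kink_next_side : (D.kink p sgn side).next (Sum.inr side) = Sum.inl (D.next p) := by
  classical
  exact congrArg (Equiv.sumCongr D.next (Equiv.refl Bool)) (Equiv.swap_apply_right _ _)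

theorem kink_next_inl {r : D.Pt} (hr : r ≠ p) :
    (D.kink p sgn side).next (Sum.inl r) = Sum.inl (D.next r) := by
  classical
  exact congrArg (Equiv.sumCongr D.next (Equiv.refl Bool))
    (Equiv.swap_apply_of_ne_of_ne (by simpa using hr) (by simp))

theorem kink_next_not_side : (D.kink p sgn side).next (Sum.inr !side) = Sum.inr !side := by
  classical
  exact congrArg (Equiv.sumCongr D.next (Equiv.refl Bool))
    (Equiv.swap_apply_of_ne_of_ne (by simp) (by simp))

theorem circle_kink_side :
    (D.kink p sgn side).circle (Sum.inr side) = (D.kink p sgn side).circle (Sum.inl p) :=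
  (congrArg _ (D.kink_next_arc p sgn side)).symm.trans ((D.kink p sgn side).circle_next _)

/-- The inclusion of the Seifert circles when a kink is added. -/
noncomputable def kinkCircle : D.Loop D.orientedState →
    (D.kink p sgn side).Loop (D.kink p sgn side).orientedState :=
  D.circleLift (fun r => (D.kink p sgn side).circle (Sum.inl r)) fun r => by
    by_cases hr : r = p
    · subst hr
      rw [← kink_next_side D r sgn side]
      exact ((D.kink r sgn side).circle_next _).trans (D.circle_kink_side r sgn side)
    · rw [← kink_next_inl D p sgn side hr]
      exact (D.kink p sgn side).circle_next _

/-- The Seifert circle of the original diagram, or `none` for the small circle of the kink. -/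
noncomputable def kinkCircleInv : (D.kink p sgn side).Loop (D.kink p sgn side).orientedState →
    Option (D.Loop D.orientedState) :=
  (D.kink p sgn side).circleLift
    (Sum.elim (fun r => some (D.circle r)) fun b => if b = side then some (D.circle p) else none)
    (by
      rintro (r | b)
      · by_cases hr : r = p
        · rw [hr, kink_next_arc]
          simp
        · rw [kink_next_inl _ _ _ _ hr]
          simp [circle_next]
      · by_cases hb : b = side
        · rw [hb, kink_next_side]
          simp [circle_next]
        · obtain rfl : b = !side := by cases b <;> cases side <;> simp_all
          rw [kink_next_not_side])

theorem kinkCircleInv_kinkCircle (v : D.Loop D.orientedState) :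
    D.kinkCircleInv p sgn side (D.kinkCircle p sgn side v) = some v := by
  obtain ⟨r, rfl⟩ := D.circle_surjective v
  rfl

/-- The small circle of the kink. -/
noncomputable def smallCircle : (D.kink p sgn side).Loop (D.kink p sgn side).orientedState :=
  (D.kink p sgn side).circle (Sum.inr !side)

theorem kinkCircleInv_small :
    D.kinkCircleInv p sgn side (D.smallCircle p sgn side) = none := by
  have h : (if (!side) = side then some (D.circle p) else none) = none := by simp
  exact h

theorem kinkCircle_injective : Function.Injective (D.kinkCircle p sgn side) := fun v w h => by
  have := congrArg (D.kinkCircleInv p sgn side) h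
  rwa [kinkCircleInv_kinkCircle, kinkCircleInv_kinkCircle, Option.some_inj] at this

theorem kinkCircle_ne_small (v : D.Loop D.orientedState) :
    D.kinkCircle p sgn side v ≠ D.smallCircle p sgn side := fun h => by
  have := congrArg (D.kinkCircleInv p sgn side) h
  rw [kinkCircleInv_kinkCircle, kinkCircleInv_small] at this
  exact Option.some_ne_none _ this

theorem kink_orientedState_iff (σ : (D.kink p sgn side).State) :
    ((∀ c : D.Cr, σ (some c) = D.orientedState c) ∧ σ none = !sgn) ↔
      σ = (D.kink p sgn side).orientedState := by
  constructor
  · rintro ⟨h1, h2⟩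
    funext c
    rcases c with _ | c
    · exact h2
    · exact h1 c
  · rintro rfl
    exact ⟨fun c => rfl, rfl⟩

theorem onOriented_kinkMap {z : D.Chain} (hz : OnOriented z) :
    OnOriented (D.kinkMap p sgn side z) := by
  intro s hs
  rw [kinkMap, ofCoeff_apply_of_onOriented _ hz]
  refine Finset.sum_eq_zero fun l _ => ?_
  rw [if_neg, zero_mul]
  exact fun h => hs ((D.kink_orientedState_iff p sgn side _).mp h)

theorem kink_labels_iff (l : D.Loop D.orientedState → KhLabel)
    (l' : (D.kink p sgn side).Loop (D.kink p sgn side).orientedState → KhLabel) :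
    (∀ q : D.Pt, label ((D.kink p sgn side).orientedEnhanced l') (Sum.inl q) =
      label (D.orientedEnhanced l) q) ↔ l = l' ∘ D.kinkCircle p sgn side := by
  constructor
  · intro h
    funext v
    obtain ⟨r, rfl⟩ := D.circle_surjective v
    exact (h r).symm
  · rintro rfl
    exact fun q => rfl

-- This inverts the term `(x a) ⊗ 1` of a positive kink: it is nonzero only for `a = 1`, so the
-- source labelling is recovered by putting `1` back on the circle of `p`.
open Classical in
theorem kink_labels_update_iff (l : D.Loop D.orientedState → KhLabel)
    (l' : (D.kink p sgn side).Loop (D.kink p sgn side).orientedState → KhLabel) :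
    (label (D.orientedEnhanced l) p = KhLabel.one ∧
      ∀ q : D.Pt, label ((D.kink p sgn side).orientedEnhanced l') (Sum.inl q) =
        if D.loop D.orientedState q = D.loop D.orientedState p then KhLabel.x
        else label (D.orientedEnhanced l) q) ↔
      l = Function.update (l' ∘ D.kinkCircle p sgn side) (D.circle p) KhLabel.one ∧
      l' (D.kinkCircle p sgn side (D.circle p)) = KhLabel.x := by
  constructor
  · rintro ⟨h1, h2⟩
    refine ⟨?_, ?_⟩
    · funext v
      obtain ⟨r, rfl⟩ := D.circle_surjective v
      by_cases hr : D.circle r = D.circle p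
      · rw [hr, Function.update_self]
        exact h1
      · rw [Function.update_of_ne hr]
        exact ((h2 r).trans (if_neg hr)).symm
    · exact (h2 p).trans (if_pos rfl)
  · rintro ⟨rfl, h⟩
    refine ⟨?_, fun q => ?_⟩
    · rw [label_orientedEnhanced, Function.update_self]
    · by_cases hq : D.circle q = D.circle p
      · refine Eq.trans ?_ (if_pos hq).symm
        exact (congrArg (l' ∘ D.kinkCircle p sgn side) hq).trans h
      · refine Eq.trans ?_ (if_neg hq).symm
        exact (Function.update_of_ne hq _ (l' ∘ D.kinkCircle p sgn side)).symm

open Classical in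
theorem kinkMap_negative_apply {z : D.Chain} (hz : OnOriented z)
    (l' : (D.kink p false side).Loop (D.kink p false side).orientedState → KhLabel) :
    D.kinkMap p false side z ((D.kink p false side).orientedEnhanced l') =
      if l' (D.smallCircle p false side) = KhLabel.one then
        z (D.orientedEnhanced (l' ∘ D.kinkCircle p false side)) else 0 := by
  rw [kinkMap, ofCoeff_apply_of_unique _ hz _ (l' ∘ D.kinkCircle p false side),
    if_pos ((D.kink_orientedState_iff p false side _).mpr rfl), if_neg Bool.false_ne_true,
    D.kink_labels_iff]
  · simp only [true_and, ite_mul, one_mul, zero_mul]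
    rfl
  · intro l hl
    rw [if_pos ((D.kink_orientedState_iff p false side _).mpr rfl), if_neg Bool.false_ne_true,
      if_neg]
    rw [D.kink_labels_iff]
    exact fun h => hl h.1

-- In terms of monomials, a positive kink multiplies by the variable of the small circle minus the
-- variable of the circle of `p`.
open Classical in
theorem kinkMap_positive_apply {z : D.Chain} (hz : OnOriented z)
    (l' : (D.kink p true side).Loop (D.kink p true side).orientedState → KhLabel) :
    D.kinkMap p true side z ((D.kink p true side).orientedEnhanced l') =
      (if l' (D.smallCircle p true side) = KhLabel.x then
        z (D.orientedEnhanced (l' ∘ D.kinkCircle p true side)) else 0) -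
      if l' (D.smallCircle p true side) = KhLabel.one ∧
          l' (D.kinkCircle p true side (D.circle p)) = KhLabel.x then
        z (D.orientedEnhanced (Function.update (l' ∘ D.kinkCircle p true side) (D.circle p)
          KhLabel.one)) else 0 := by
  rw [kinkMap, ofCoeff_apply_of_onOriented _ hz]
  calc _ = ∑ l, ((if l = l' ∘ D.kinkCircle p true side then
        if l' (D.smallCircle p true side) = KhLabel.x then
          z (D.orientedEnhanced l) else 0 else 0) -
      if l = Function.update (l' ∘ D.kinkCircle p true side) (D.circle p) KhLabel.one then
        if l' (D.smallCircle p true side) = KhLabel.one ∧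
          l' (D.kinkCircle p true side (D.circle p)) = KhLabel.x then
          z (D.orientedEnhanced l) else 0 else 0) := Finset.sum_congr rfl fun l _ => ?_
    _ = _ := ?_
  · rw [if_pos ((D.kink_orientedState_iff p true side _).mpr rfl), if_pos rfl, sub_mul,
      ite_mul, ite_mul, one_mul, zero_mul, ← ite_and, ← ite_and]
    congr 1
    · refine if_congr ?_ rfl rfl
      rw [D.kink_labels_iff]
      exact Iff.rfl
    · refine if_congr ?_ rfl rfl
      rw [← and_assoc, D.kink_labels_update_iff, and_assoc, and_comm (a := _ = KhLabel.x)]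
      exact Iff.rfl
  · rw [Finset.sum_sub_distrib, Finset.sum_ite_eq', Finset.sum_ite_eq']
    simp only [Finset.mem_univ, if_true]

end Kink

/-! ### Saddles that absorb a small circle -/

section Absorb

variable {D : LinkDiagram} {p q : D.Pt}

theorem saddle_next_left : (D.saddle p q).next p = D.next q := by
  classical
  exact congrArg D.next (Equiv.swap_apply_left _ _)

theorem saddle_next_right : (D.saddle p q).next q = D.next p := by
  classical
  exact congrArg D.next (Equiv.swap_apply_right _ _)

theorem saddle_next_of_ne {r : D.Pt} (hp : r ≠ p) (hq : r ≠ q) :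
    (D.saddle p q).next r = D.next r := by
  classical
  exact congrArg D.next (Equiv.swap_apply_of_ne_of_ne hp hq)

theorem circle_saddle_eq (hp : D.next p = p) :
    (D.saddle p q).circle p = (D.saddle p q).circle q := by
  have h := (D.saddle p q).circle_next q
  rwa [saddle_next_right, hp] at h

/-- The map on Seifert circles of a saddle that merges the circle consisting of the point `p`
with the circle of `q`. -/
noncomputable def absorb (hp : D.next p = p) (q : D.Pt) :
    D.Loop D.orientedState → (D.saddle p q).Loop (D.saddle p q).orientedState :=
  D.circleLift (fun r => (D.saddle p q).circle r) fun r => by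
    by_cases h1 : r = p
    · rw [h1, hp]
    · by_cases h2 : r = q
      · rw [h2, ← circle_saddle_eq hp, ← saddle_next_left (p := p) (q := q)]
        exact (D.saddle p q).circle_next _
      · rw [← saddle_next_of_ne h1 h2]
        exact (D.saddle p q).circle_next _

open Classical in
/-- A section of `absorb`, which takes the merged circle to the circle of `q`. -/
noncomputable def absorbInv (p q : D.Pt) :
    (D.saddle p q).Loop (D.saddle p q).orientedState → D.Loop D.orientedState :=
  (D.saddle p q).circleLift
    (fun r => if D.circle r = D.circle p then D.circle q else D.circle r) (by
      have key : ∀ r : D.Pt, (if D.circle ((D.saddle p q).next r) = D.circle p then D.circle q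
          else D.circle ((D.saddle p q).next r)) =
          if D.circle r = D.circle p then D.circle q else D.circle r := by
        intro r
        by_cases h1 : r = p
        · rw [h1, saddle_next_left, circle_next]
          simp
        · by_cases h2 : r = q
          · rw [h2, saddle_next_right, circle_next]
            simp
          · rw [saddle_next_of_ne h1 h2, circle_next]
      exact key)

theorem absorbInv_absorb (hp : D.next p = p) {v : D.Loop D.orientedState} (hv : v ≠ D.circle p) :
    absorbInv p q (absorb hp q v) = v := by
  obtain ⟨r, rfl⟩ := D.circle_surjective v
  exact if_neg hv

theorem onOriented_saddleMap {z : D.Chain} (hz : OnOriented z) : OnOriented (D.saddleMap p q z) := by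
  intro s hs
  rw [saddleMap, ofCoeff_apply_of_onOriented _ hz]
  refine Finset.sum_eq_zero fun l _ => ?_
  rw [if_neg, zero_mul]
  exact fun h => hs h.1

-- A merged label `1` can only come from `1 · 1`, and a merged label `x` only from `1 · x` or `x ·
-- 1`. In terms of monomials, the variables of the two circles are identified. As `p` is a circle of
-- its own, different from that of `q`, the comultiplication does not occur.
open Classical in
theorem saddleMap_absorb_apply (hp : D.next p = p) (hpq : D.circle p ≠ D.circle q)
    {z : D.Chain} (hz : OnOriented z)
    (l' : (D.saddle p q).Loop (D.saddle p q).orientedState → KhLabel) :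
    D.saddleMap p q z ((D.saddle p q).orientedEnhanced l') =
      if l' ((D.saddle p q).circle p) = KhLabel.one then
        z (D.orientedEnhanced (l' ∘ absorb hp q))
      else
        z (D.orientedEnhanced (Function.update (l' ∘ absorb hp q) (D.circle p) KhLabel.one)) +
        z (D.orientedEnhanced (Function.update (l' ∘ absorb hp q) (D.circle q) KhLabel.one)) := by
  set m := l' ∘ absorb hp q with hm
  have hmp : m (D.circle p) = l' ((D.saddle p q).circle p) := rfl
  have hmq : m (D.circle q) = l' ((D.saddle p q).circle p) :=
    congrArg l' (circle_saddle_eq hp).symm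
  -- labels that agree with `m` away from the two circles are determined by two values
  have hext : ∀ l l₀ : D.Loop D.orientedState → KhLabel,
      (∀ v, v ≠ D.circle p → v ≠ D.circle q → m v = l v) →
      (∀ v, v ≠ D.circle p → v ≠ D.circle q → m v = l₀ v) →
      (l = l₀ ↔ l (D.circle p) = l₀ (D.circle p) ∧ l (D.circle q) = l₀ (D.circle q)) := by
    intro l l₀ h h₀
    refine ⟨fun h => h ▸ ⟨rfl, rfl⟩, fun ⟨h1, h2⟩ => ?_⟩
    funext v
    by_cases hvp : v = D.circle p
    · rw [hvp, h1]
    · by_cases hvq : v = D.circle q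
      · rw [hvq, h2]
      · rw [← h v hvp hvq, h₀ v hvp hvq]
  have hcond : ∀ l : D.Loop D.orientedState → KhLabel,
      (((D.saddle p q).orientedEnhanced l').1 = (D.orientedEnhanced l).1 ∧ ∀ r : D.Pt,
        D.loop (D.orientedEnhanced l).1 r ≠ D.loop (D.orientedEnhanced l).1 p →
        D.loop (D.orientedEnhanced l).1 r ≠ D.loop (D.orientedEnhanced l).1 q →
        label (D := D.saddle p q) ((D.saddle p q).orientedEnhanced l') r =
          label (D.orientedEnhanced l) r) ↔
      ∀ v, v ≠ D.circle p → v ≠ D.circle q → m v = l v := by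
    intro l
    constructor
    · intro h v
      obtain ⟨r, rfl⟩ := D.circle_surjective v
      exact h.2 r
    · exact fun h => ⟨rfl, fun r => h (D.circle r)⟩
  have hneq : ∀ l : D.Loop D.orientedState → KhLabel,
      D.loop (D.orientedEnhanced l).1 p ≠ D.loop (D.orientedEnhanced l).1 q := fun _ => hpq
  rw [saddleMap, ofCoeff_apply_of_onOriented _ hz]
  rw [← hmp] at hmq ⊢
  trans ∑ l, (if ∀ v, v ≠ D.circle p → v ≠ D.circle q → m v = l v then
      mulCoeff (l (D.circle p)) (l (D.circle q)) (m (D.circle p)) else 0) *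
        z (D.orientedEnhanced l)
  · exact Finset.sum_congr rfl fun l _ => congrArg (· * z (D.orientedEnhanced l))
      (if_congr (hcond l) (if_pos (hneq l)) rfl)
  split_ifs with h1
  · rw [h1] at hmq
    rw [Finset.sum_eq_single m]
    · rw [if_pos (fun _ _ _ => rfl), h1, hmq]
      simp [mulCoeff]
    · intro l _ hl
      split_ifs with h
      · rw [ne_eq, hext l m h fun _ _ _ => rfl, h1, hmq] at hl
        rw [h1]
        cases ha : l (D.circle p) <;> cases hb : l (D.circle q) <;> simp_all [mulCoeff]
      · rw [zero_mul]
    · exact fun h => absurd (Finset.mem_univ _) h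
  · have h2 : m (D.circle p) = KhLabel.x := by
      cases h : m (D.circle p)
      · exact absurd h h1
      · rfl
    rw [h2] at hmq
    have hu1 : ∀ v, v ≠ D.circle p → v ≠ D.circle q →
        m v = Function.update m (D.circle p) KhLabel.one v :=
      fun v hv _ => (Function.update_of_ne hv _ _).symm
    have hu2 : ∀ v, v ≠ D.circle p → v ≠ D.circle q →
        m v = Function.update m (D.circle q) KhLabel.one v :=
      fun v _ hv => (Function.update_of_ne hv _ _).symm
    have key : ∀ l : D.Loop D.orientedState → KhLabel,
        (if ∀ v, v ≠ D.circle p → v ≠ D.circle q → m v = l v then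
          mulCoeff (l (D.circle p)) (l (D.circle q)) (m (D.circle p)) else 0) *
          z (D.orientedEnhanced l) =
        (if l = Function.update m (D.circle p) KhLabel.one then z (D.orientedEnhanced l) else 0) +
        if l = Function.update m (D.circle q) KhLabel.one then z (D.orientedEnhanced l) else 0 := by
      intro l
      by_cases h : ∀ v, v ≠ D.circle p → v ≠ D.circle q → m v = l v
      · rw [if_pos h, if_congr (hext l _ h hu1) rfl rfl, if_congr (hext l _ h hu2) rfl rfl,
          Function.update_self, Function.update_self,
          Function.update_of_ne hpq, Function.update_of_ne hpq.symm, h2, hmq]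
        cases l (D.circle p) <;> cases l (D.circle q) <;> simp [mulCoeff]
      · rw [if_neg h, if_neg (fun h' => h (by rw [h']; exact hu1)),
          if_neg (fun h' => h (by rw [h']; exact hu2))]
        simp
    rw [Finset.sum_congr rfl fun l _ => key l, Finset.sum_add_distrib, Finset.sum_ite_eq',
      Finset.sum_ite_eq']
    simp only [Finset.mem_univ, if_true]

end Absorb

/-! ### The twist-and-glue move -/

section TwistGlue

variable (D : LinkDiagram) (p q : D.Pt) (sgn side : Bool)

/-- The Seifert circles do not change under a twist-and-glue move. -/
noncomputable def twistGlueCircle : D.Loop D.orientedState →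
    (D.twistGlue p q sgn side).Loop (D.twistGlue p q sgn side).orientedState :=
  absorb (D.kink_next_not_side p sgn side) (Sum.inl q) ∘ D.kinkCircle p sgn side

theorem circle_twistGlue_side : (D.twistGlue p q sgn side).circle (Sum.inr side) =
    D.twistGlueCircle p q sgn side (D.circle p) :=
  congrArg (absorb (D.kink_next_not_side p sgn side) (Sum.inl q)) (D.circle_kink_side p sgn side)

theorem circle_twistGlue_not_side : (D.twistGlue p q sgn side).circle (Sum.inr !side) =
    D.twistGlueCircle p q sgn side (D.circle q) :=
  circle_saddle_eq (D.kink_next_not_side p sgn side)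

/-- The kink creates one small circle and the saddle absorbs it into the circle of `q`. Injectivity
follows since `absorbInv` undoes the absorption away from the small circle. -/
theorem twistGlueCircle_bijective : Function.Bijective (D.twistGlueCircle p q sgn side) := by
  constructor
  · refine Function.Injective.of_comp (f := absorbInv (D := D.kink p sgn side) (Sum.inr !side)
      (Sum.inl q)) ?_
    have h : absorbInv (D := D.kink p sgn side) (Sum.inr !side) (Sum.inl q) ∘
        D.twistGlueCircle p q sgn side = D.kinkCircle p sgn side :=
      funext fun v => absorbInv_absorb (D.kink_next_not_side p sgn side) (D.kinkCircle_ne_small p sgn side v)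
    rw [h]
    exact D.kinkCircle_injective p sgn side
  · intro v
    obtain ⟨r | b, rfl⟩ := (D.twistGlue p q sgn side).circle_surjective v
    · exact ⟨D.circle r, rfl⟩
    · by_cases hb : b = side
      · exact ⟨D.circle p, by rw [hb, circle_twistGlue_side]⟩
      · obtain rfl : b = !side := by cases b <;> cases side <;> simp_all
        exact ⟨D.circle q, (D.circle_twistGlue_not_side p q sgn side).symm⟩

theorem twistGlue_pos_some (c : D.Cr) : (D.twistGlue p q sgn side).pos (some c) = D.pos c := rfl

theorem seifertPoly_twistGlue : (D.twistGlue p q sgn side).seifertPoly =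
    (if sgn = true then MvPolynomial.X ((D.twistGlue p q sgn side).circle (Sum.inr true)) -
      MvPolynomial.X ((D.twistGlue p q sgn side).circle (Sum.inr false)) else 1) *
    MvPolynomial.rename (D.twistGlueCircle p q sgn side) D.seifertPoly := by
  let _ : Fintype (D.twistGlue p q sgn side).Cr := instFintypeOption (α := D.Cr)
  rw [seifertPoly_eq_prod (D.twistGlue p q sgn side), seifertPoly_eq_prod D, map_prod]
  refine (Fintype.prod_option _).trans ?_
  congr 1
  refine Finset.prod_congr rfl fun c _ => ?_
  rw [twistGlue_pos_some]
  split_ifs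
  · rw [map_sub, MvPolynomial.rename_X, MvPolynomial.rename_X]
    rfl
  · rw [map_one]

theorem coeff_rename_twistGlue
    (l : (D.twistGlue p q sgn side).Loop (D.twistGlue p q sgn side).orientedState → KhLabel)
    (P : MvPolynomial (D.Loop D.orientedState) ℤ) :
    (MvPolynomial.rename (D.twistGlueCircle p q sgn side) P).coeff (squareFree (xSet l)) =
      P.coeff (squareFree (xSet (l ∘ D.twistGlueCircle p q sgn side))) := by
  classical
  rw [coeff_xSet_rename (D.twistGlueCircle_bijective p q sgn side).1, if_pos]
  exact fun v hv => absurd ((D.twistGlueCircle_bijective p q sgn side).2 v) hv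

theorem onOriented_twistGlueMap {z : D.Chain} (hz : OnOriented z) :
    OnOriented (D.twistGlueMap p q sgn side z) :=
  onOriented_saddleMap (D.onOriented_kinkMap p sgn side hz)

-- The labelling `m` is `l` pulled back through the absorption. The formulas for kinks use only its
-- values on the old circles and on the small circle, so nothing else about it is recorded.
open Classical in
theorem twistGlueMap_apply {z : D.Chain} (hz : OnOriented z)
    (l : (D.twistGlue p q sgn side).Loop (D.twistGlue p q sgn side).orientedState → KhLabel) :
    ∃ m : (D.kink p sgn side).Loop (D.kink p sgn side).orientedState → KhLabel,
      m ∘ D.kinkCircle p sgn side = l ∘ D.twistGlueCircle p q sgn side ∧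
      m (D.smallCircle p sgn side) = l (D.twistGlueCircle p q sgn side (D.circle q)) ∧
      D.twistGlueMap p q sgn side z ((D.twistGlue p q sgn side).orientedEnhanced l) =
        if l (D.twistGlueCircle p q sgn side (D.circle q)) = KhLabel.one then
          D.kinkMap p sgn side z ((D.kink p sgn side).orientedEnhanced m)
        else
          D.kinkMap p sgn side z ((D.kink p sgn side).orientedEnhanced
            (Function.update m (D.smallCircle p sgn side) KhLabel.one)) +
          D.kinkMap p sgn side z ((D.kink p sgn side).orientedEnhanced
            (Function.update m (D.kinkCircle p sgn side (D.circle q)) KhLabel.one)) := by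
  refine ⟨l ∘ absorb (D.kink_next_not_side p sgn side) (Sum.inl q), rfl,
    congrArg l (D.circle_twistGlue_not_side p q sgn side), ?_⟩
  rw [← circle_twistGlue_not_side]
  exact saddleMap_absorb_apply (D.kink_next_not_side p sgn side)
    (D.kinkCircle_ne_small p sgn side (D.circle q)).symm (D.onOriented_kinkMap p sgn side hz) l

/-- A negative kink labels the small circle `1`, the unit of the multiplication in the saddle, so
the move keeps all coefficients. A negative crossing contributes no factor to the Seifert polynomial
either. -/
theorem isSeifertChain_negativeTwistGlue {z : D.Chain} (hz : IsSeifertChain z) :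
    IsSeifertChain (D.twistGlueMap p q false side z) := by
  classical
  obtain ⟨hz, ε, hε⟩ := hz
  refine ⟨D.onOriented_twistGlueMap p q false side hz, ε, fun l => ?_⟩
  obtain ⟨m, hm, hsmall, h⟩ := D.twistGlueMap_apply p q false side hz l
  rw [seifertPoly_twistGlue, if_neg Bool.false_ne_true, one_mul, coeff_rename_twistGlue, ← hε, h]
  by_cases hq : l (D.twistGlueCircle p q false side (D.circle q)) = KhLabel.one
  · rw [if_pos hq, D.kinkMap_negative_apply p side hz, hsmall, if_pos hq, hm]
  · rw [if_neg hq, D.kinkMap_negative_apply p side hz, D.kinkMap_negative_apply p side hz,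
      Function.update_self, if_pos rfl,
      Function.update_of_ne (D.kinkCircle_ne_small p false side _).symm, hsmall, if_neg hq,
      add_zero, Function.update_comp_eq_of_forall_ne _ _ (D.kinkCircle_ne_small p false side), hm]

-- This is multiplication by `X_q - X_p` modulo squares: the coefficient at a monomial is obtained
-- by deleting `X_q`, minus the same with `X_p`. If `p` and `q` lie on the same circle, the two
-- terms cancel.
open Classical in
theorem twistGlueMap_positive_apply {z : D.Chain} (hz : OnOriented z)
    (l : (D.twistGlue p q true side).Loop (D.twistGlue p q true side).orientedState → KhLabel) :
    D.twistGlueMap p q true side z ((D.twistGlue p q true side).orientedEnhanced l) =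
      (if l (D.twistGlueCircle p q true side (D.circle q)) = KhLabel.x then
        z (D.orientedEnhanced (Function.update (l ∘ D.twistGlueCircle p q true side)
          (D.circle q) KhLabel.one)) else 0) -
      if l (D.twistGlueCircle p q true side (D.circle p)) = KhLabel.x then
        z (D.orientedEnhanced (Function.update (l ∘ D.twistGlueCircle p q true side)
          (D.circle p) KhLabel.one)) else 0 := by
  obtain ⟨m, hm, hsmall, h⟩ := D.twistGlueMap_apply p q true side hz l
  have hp : ∀ v, m (D.kinkCircle p true side v) = l (D.twistGlueCircle p q true side v) :=
    fun v => congrFun hm v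
  rw [h]
  by_cases hq : l (D.twistGlueCircle p q true side (D.circle q)) = KhLabel.one
  · rw [if_pos hq, D.kinkMap_positive_apply p side hz, hsmall, hq, hp, hm]
    simp
  · have hq' : l (D.twistGlueCircle p q true side (D.circle q)) = KhLabel.x := by
      cases h : l (D.twistGlueCircle p q true side (D.circle q))
      · exact absurd h hq
      · rfl
    rw [if_neg hq, D.kinkMap_positive_apply p side hz, D.kinkMap_positive_apply p side hz,
      Function.update_self, Function.update_of_ne (D.kinkCircle_ne_small p true side _),
      Function.update_of_ne (D.kinkCircle_ne_small p true side _).symm, hsmall, hp, hq',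
      Function.update_comp_eq_of_forall_ne _ _ (D.kinkCircle_ne_small p true side),
      Function.update_comp_eq_of_injective _ (D.kinkCircle_injective p true side), hm]
    simp [sub_eq_neg_add]

theorem isSeifertChain_positiveTwistGlue {z : D.Chain} (hz : IsSeifertChain z) :
    IsSeifertChain (D.twistGlueMap p q true side z) := by
  classical
  obtain ⟨hz, ε, hε⟩ := hz
  -- The Seifert polynomial takes right minus left, whereas the move takes `q` minus `p`; `η`
  -- depends on which side `p` is.
  obtain ⟨η, hη⟩ : ∃ η : ℤˣ, (D.twistGlue p q true side).seifertPoly =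
      MvPolynomial.C (η : ℤ) * MvPolynomial.rename (D.twistGlueCircle p q true side)
        ((MvPolynomial.X (D.circle q) - MvPolynomial.X (D.circle p)) * D.seifertPoly) := by
    have hp := D.circle_twistGlue_side p q true side
    have hq := D.circle_twistGlue_not_side p q true side
    rw [seifertPoly_twistGlue, if_pos rfl]
    cases side
    · refine ⟨1, ?_⟩
      rw [Bool.not_false] at hq
      rw [hp, hq]
      simp
    · refine ⟨-1, ?_⟩
      rw [Bool.not_true] at hq
      rw [hp, hq]
      simp
      ring
  refine ⟨D.onOriented_twistGlueMap p q true side hz, ε * η, fun l => ?_⟩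
  have hsq : (η : ℤ) * η = 1 := by
    rw [← Units.val_mul, Int.units_mul_self, Units.val_one]
  -- The factor `X_q - X_p` is regarded as the only edge of a multigraph with edge set `Unit`.
  rw [hη, MvPolynomial.coeff_C_mul, coeff_rename_twistGlue,
    coeff_squareFree_edge_mul (fun _ : Unit => D.circle p) (fun _ : Unit => D.circle q) (),
    D.twistGlueMap_positive_apply p q side hz, hε, hε, xSet_update_one, xSet_update_one]
  simp only [mem_xSet, Function.comp_apply, Units.val_mul]
  have h3 : ∀ a : ℤ, ε * η * (η * a) = ε * a := fun a => by linear_combination ε * a * hsq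
  rw [h3, mul_sub, mul_ite, mul_ite, mul_zero]

end TwistGlue

/-- This is an invariant of all frames. Planarity plays no role, and a twist-and-glue move may even
join two arcs of the same Seifert circle. -/
theorem Film.isSeifertChain {i : Scene} {D : LinkDiagram} (m : Film i D) :
    IsSeifertChain m.chain := by
  induction m with
  | start => exact isSeifertChain_empty
  | birth m ih => exact isSeifertChain_birthMap ih
  | beginNegative m ih => exact ih
  | negativeTwistGlue m p q side ih => exact isSeifertChain_negativeTwistGlue _ p q side ih
  | beginPositive m ih => exact ih
  | positiveTwistGlue m p q side ih => exact isSeifertChain_positiveTwistGlue _ p q side ih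
  | thin m t ih => exact t.isSeifertChain_map ih
  | thicken m t ih => exact t.isSeifertChain_mapBack ih

end LinkDiagram

namespace LinkDiagram

/-! ### Seifert circles of planar diagrams are 2-coloured -/

section Numbering

variable (D : LinkDiagram)

noncomputable instance : Fintype D.Pt := Fintype.ofFinite _

noncomputable instance : Fintype (Quot D.SameRegion) := Fintype.ofFinite _

noncomputable instance : Fintype (Quot D.SamePiece) := Fintype.ofFinite _

/-- The coboundary of a function on the points, along the arcs and across the crossings. -/
def pieceCoboundary : (D.Pt → ZMod 2) →ₗ[ZMod 2] (D.Pt ⊕ D.Cr → ZMod 2) where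
  toFun f := Sum.elim (fun p => f (D.next p) - f p)
    fun c => f (D.port (c, false)) - f (D.port (c, true))
  map_add' f g := by
    ext (p | c) <;> simp <;> ring
  map_smul' r f := by
    ext (p | c) <;> simp <;> ring

/-- The jumps of a function on the regions, across the arcs and from south to north at the
crossings. -/
def regionJump : (Quot D.SameRegion → ZMod 2) →ₗ[ZMod 2] (D.Pt ⊕ D.Cr → ZMod 2) where
  toFun k := Sum.elim
    (fun p => k (Quot.mk _ (p, true)) - k (Quot.mk _ (p, false)))
    fun c => k (Quot.mk _ (D.next.symm (D.port (c, false)), false)) -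
      k (Quot.mk _ (D.port (c, false), false))
  map_add' f g := by
    ext (p | c) <;> simp <;> ring
  map_smul' r f := by
    ext (p | c) <;> simp <;> ring

/-- The functions on the points that are constant on the connected pieces. -/
def pieceFunctions : Submodule (ZMod 2) (D.Pt → ZMod 2) :=
  LinearMap.range (LinearMap.funLeft (ZMod 2) (ZMod 2) (Quot.mk D.SamePiece))

theorem finrank_pieceFunctions_le :
    Module.finrank (ZMod 2) D.pieceFunctions ≤ Nat.card (Quot D.SamePiece) := by
  rw [Nat.card_eq_fintype_card, ← Module.finrank_fintype_fun_eq_card (ZMod 2)]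
  exact LinearMap.finrank_range_le _

variable {D} in
theorem mem_pieceFunctions {f : D.Pt → ZMod 2} (h1 : ∀ p, f (D.next p) = f p)
    (h2 : ∀ c, f (D.port (c, false)) = f (D.port (c, true))) : f ∈ D.pieceFunctions := by
  refine ⟨Quot.lift f ?_, rfl⟩
  rintro a b (p | c)
  · exact (h1 _).symm
  · exact h2 _

theorem finrank_ker_pieceCoboundary_le :
    Module.finrank (ZMod 2) (LinearMap.ker D.pieceCoboundary) ≤ Nat.card (Quot D.SamePiece) := by
  refine le_trans (Submodule.finrank_mono ?_) D.finrank_pieceFunctions_le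
  intro f hf
  rw [LinearMap.mem_ker] at hf
  exact mem_pieceFunctions (fun p => sub_eq_zero.mp (congrFun hf (Sum.inl p)))
    fun c => sub_eq_zero.mp (congrFun hf (Sum.inr c))

variable {D} in
theorem region_west (c : D.Cr) :
    Quot.mk D.SameRegion (D.next.symm (D.port (c, false)), true) =
      Quot.mk _ (D.port (c, false), true) := Quot.sound (.west c)

variable {D} in
theorem region_east (c : D.Cr) :
    Quot.mk D.SameRegion (D.next.symm (D.port (c, true)), false) =
      Quot.mk _ (D.port (c, true), false) := Quot.sound (.east c)

variable {D} in
theorem region_south (c : D.Cr) :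
    Quot.mk D.SameRegion (D.next.symm (D.port (c, false)), false) =
      Quot.mk _ (D.next.symm (D.port (c, true)), true) := Quot.sound (.south c)

variable {D} in
theorem region_north (c : D.Cr) :
    Quot.mk D.SameRegion (D.port (c, false), false) =
      Quot.mk _ (D.port (c, true), true) := Quot.sound (.north c)

variable {D} in
theorem region_mark {p : D.Pt} (h : p ∉ Set.range D.port) (side : Bool) :
    Quot.mk D.SameRegion (D.next.symm p, side) = Quot.mk _ (p, side) := Quot.sound (.mark p h side)

/-- A function on the regions without jumps across arcs has one value at each arc, the same on both
sides. Following the regions past markings and around crossings shows that this value is constant on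
connected pieces, and it determines the function because every region has an arc on its boundary. -/
theorem finrank_ker_regionJump_le :
    Module.finrank (ZMod 2) (LinearMap.ker D.regionJump) ≤ Nat.card (Quot D.SamePiece) := by
  refine le_trans ?_ D.finrank_pieceFunctions_le
  have hk : ∀ k ∈ LinearMap.ker D.regionJump, ∀ p,
      k (Quot.mk _ (p, true)) = k (Quot.mk _ (p, false)) := fun k hk p =>
    sub_eq_zero.mp (congrFun (LinearMap.mem_ker.mp hk) (Sum.inl p))
  let g : (Quot D.SameRegion → ZMod 2) →ₗ[ZMod 2] (D.Pt → ZMod 2) :=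
    LinearMap.funLeft (ZMod 2) (ZMod 2) fun p => Quot.mk _ (p, true)
  refine LinearMap.finrank_le_finrank_of_injective
    (f := (g ∘ₗ (LinearMap.ker D.regionJump).subtype).codRestrict D.pieceFunctions ?_) ?_
  · rintro ⟨k, hk'⟩
    refine mem_pieceFunctions (fun p => ?_) fun c => ?_
    · change k (Quot.mk _ (D.next p, true)) = k (Quot.mk _ (p, true))
      obtain ⟨q, rfl⟩ := D.next.symm.surjective p
      rw [Equiv.apply_symm_apply]
      by_cases hq : q ∈ Set.range D.port
      · obtain ⟨⟨c, _ | _⟩, rfl⟩ := hq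
        · rw [region_west]
        · rw [hk k hk', hk k hk', region_east]
      · rw [region_mark hq]
    · change k (Quot.mk _ (D.port (c, false), true)) = k (Quot.mk _ (D.port (c, true), true))
      rw [hk k hk', region_north]
  · rintro ⟨k, hk1⟩ ⟨k', hk2⟩ h
    have h1 : ∀ p, k (Quot.mk _ (p, true)) = k' (Quot.mk _ (p, true)) :=
      fun p => congrFun (congrArg Subtype.val h) p
    refine Subtype.ext (funext fun r => ?_)
    obtain ⟨⟨p, side⟩, rfl⟩ := Quot.exists_rep r
    cases side
    · exact (hk k hk1 p).symm.trans ((h1 p).trans (hk k' hk2 p))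
    · exact h1 p

/-- Summation by parts along `next` moves the difference from `f` to the jumps. At a marking the
jump does not change, so only ports contribute; at each crossing their contribution cancels the
crossing term, since all jumps there are differences of the values in the four surrounding regions.
-/
theorem pieceCoboundary_dotProduct_regionJump (f : D.Pt → ZMod 2)
    (k : Quot D.SameRegion → ZMod 2) : D.pieceCoboundary f ⬝ᵥ D.regionJump k = 0 := by
  set w : D.Pt → ZMod 2 := fun p => k (Quot.mk _ (p, true)) - k (Quot.mk _ (p, false)) with hw
  have h1 : ∑ p, f (D.next p) * w p = ∑ p, f p * w (D.next.symm p) := by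
    rw [← Equiv.sum_comp D.next fun p => f p * w (D.next.symm p)]
    simp
  have h2 : ∑ a : D.Cr × Bool, f (D.port a) * (w (D.next.symm (D.port a)) - w (D.port a)) =
      ∑ p, f p * (w (D.next.symm p) - w p) := by
    refine Fintype.sum_of_injective D.port D.port.injective _ _ (fun p hp => ?_) fun a => rfl
    simp only [hw, region_mark hp, sub_self, mul_zero]
  have h3 : ∑ p, (f (D.next p) - f p) * w p =
      ∑ a : D.Cr × Bool, f (D.port a) * (w (D.next.symm (D.port a)) - w (D.port a)) := by
    rw [h2]
    simp only [sub_mul, mul_sub, Finset.sum_sub_distrib, h1]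
  rw [dotProduct, Fintype.sum_sum_type]
  change ∑ p, (f (D.next p) - f p) * w p + ∑ c, (f (D.port (c, false)) - f (D.port (c, true))) *
    (k (Quot.mk _ (D.next.symm (D.port (c, false)), false)) -
      k (Quot.mk _ (D.port (c, false), false))) = 0
  rw [h3, Fintype.sum_prod_type, ← Finset.sum_add_distrib]
  refine Finset.sum_eq_zero fun c _ => ?_
  simp only [Fintype.sum_bool, hw, region_west, region_east, region_south, region_north]
  ring

variable {D}

/-- A mod 2 Alexander numbering. Euler's formula is precisely the dimension count that makes every
vector orthogonal to the coboundaries a jump vector. The vector with `1` on arcs and `0` at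
crossings is orthogonal to them because `next` is a permutation. -/
theorem Planar.exists_numbering (hD : D.Planar) :
    ∃ k : Quot D.SameRegion → ZMod 2,
      ∀ p, k (Quot.mk _ (p, true)) - k (Quot.mk _ (p, false)) = 1 := by
  classical
  obtain ⟨k, hk⟩ := mem_range_of_orthogonal D.pieceCoboundary D.regionJump
    D.pieceCoboundary_dotProduct_regionJump (by
      have h1 := D.finrank_ker_pieceCoboundary_le
      have h2 := D.finrank_ker_regionJump_le
      have h3 : Nat.card _ = Nat.card _ + 2 * Nat.card _ := hD
      rw [Fintype.card_sum, ← Nat.card_eq_fintype_card, ← Nat.card_eq_fintype_card,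
        ← Nat.card_eq_fintype_card]
      omega) (w := Sum.elim (fun _ => 1) fun _ => 0) (fun f => by
      rw [dotProduct, Fintype.sum_sum_type]
      simp only [Sum.elim_inl, Sum.elim_inr, mul_one, mul_zero, Finset.sum_const_zero, add_zero]
      change ∑ p, (f (D.next p) - f p) = 0
      rw [Finset.sum_sub_distrib, Equiv.sum_comp D.next f, sub_self])
  exact ⟨k, fun p => congrFun hk (Sum.inl p)⟩

/-- The Seifert circles of a planar diagram have a 2-colouring, in which any two circles that meet
at a crossing have different colours. -/
theorem Planar.exists_coloring (hD : D.Planar) :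
    ∃ χ : D.Loop D.orientedState → ℤˣ,
      ∀ c, χ (D.circle (D.port (c, true))) = -χ (D.circle (D.port (c, false))) := by
  classical
  obtain ⟨k, hk⟩ := hD.exists_numbering
  have hk' : ∀ p, k (Quot.mk _ (p, true)) = k (Quot.mk _ (p, false)) + 1 :=
    fun p => by rw [← hk p]; ring
  -- The number on the right persists along a Seifert circle: past a right port the region on the
  -- right is the same, and past a left port the region on the left is the same and its number is
  -- one more.
  have hnext : ∀ p, k (Quot.mk _ (D.next p, false)) = k (Quot.mk _ (p, false)) := by
    intro p
    obtain ⟨q, rfl⟩ := D.next.symm.surjective p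
    rw [Equiv.apply_symm_apply]
    by_cases hq : q ∈ Set.range D.port
    · obtain ⟨⟨c, _ | _⟩, rfl⟩ := hq
      · have h := congrArg k (region_west c)
        rw [hk', hk'] at h
        exact (add_right_cancel h).symm
      · rw [region_east]
    · rw [region_mark hq]
  -- A circle is coloured by the number of the region on its right.
  refine ⟨fun v => if D.circleLift (fun p => k (Quot.mk _ (p, false))) hnext v = 0 then 1 else -1, fun c => ?_⟩
  beta_reduce
  -- The north region is on the right of the left strand and on the left of the right strand, so the
  -- two numbers on the right differ by one.
  rw [circleLift_circle, circleLift_circle, region_north, hk']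
  generalize k (Quot.mk _ (D.port (c, true), false)) = a
  revert a
  decide

end Numbering

end LinkDiagram

/-! ### The trace graph of the oriented smoothing. -/

namespace LinkDiagram

variable {D : LinkDiagram}

theorem traceEnd_orientedState (c : D.Cr) (b : Bool) :
    D.traceEnd D.orientedState c b = D.circle (D.port (c, b)) := by
  cases b
  · rfl
  · exact if_pos rfl

theorem mem_zeroTraces_orientedState {c : D.Cr} :
    c ∈ D.zeroTraces D.orientedState ↔ D.pos c = true := by
  change (!D.pos c) = false ↔ _
  simp

/-! ### Betti numbers -/

/-- The conservation law at every vertex is orthogonality to all coboundaries; indicator functions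
of single vertices give the law back. -/
theorem mem_cycleSpace_iff {σ : D.State} {E : Set D.Cr} {w : D.Cr → ℚ} :
    w ∈ D.cycleSpace σ E ↔ (∀ c ∉ E, w c = 0) ∧ ∀ f : D.Loop σ → ℚ,
      ∑ c, (f (D.traceEnd σ c true) - f (D.traceEnd σ c false)) * w c = 0 := by
  classical
  have key : ∀ (b : Bool) (f : D.Loop σ → ℚ), ∑ c, f (D.traceEnd σ c b) * w c =
      ∑ v, f v * ∑ᶠ c : D.Cr, if D.traceEnd σ c b = v then w c else 0 := by
    intro b f
    simp only [finsum_eq_sum_of_fintype, Finset.mul_sum]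
    rw [Finset.sum_comm]
    simp
  have hmem : w ∈ D.cycleSpace σ E ↔ (∀ c ∉ E, w c = 0) ∧ ∀ v : D.Loop σ,
      (∑ᶠ c : D.Cr, if D.traceEnd σ c true = v then w c else 0) =
        ∑ᶠ c : D.Cr, if D.traceEnd σ c false = v then w c else 0 := by
    refine Iff.trans Iff.rfl (and_congr Iff.rfl (forall_congr' fun v => ?_))
    convert Iff.rfl
  rw [hmem]
  refine and_congr Iff.rfl ⟨fun h f => ?_, fun h v => ?_⟩
  · simp only [sub_mul, Finset.sum_sub_distrib, key, h, sub_self]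
  · have := h (Pi.single v 1)
    simp only [sub_mul, Finset.sum_sub_distrib, key] at this
    simpa [Pi.single_apply, sub_eq_zero] using this

/-- The first Betti number of a connected multigraph of traces. -/
theorem firstBetti_add_card {σ : D.State} {E : Finset D.Cr} {V : Finset (D.Loop σ)}
    (hV : V.Nonempty) (hends : ∀ c ∈ E, ∀ b, D.traceEnd σ c b ∈ V)
    (hconn : ∀ p : D.Loop σ → Prop,
      (∀ c ∈ E, p (D.traceEnd σ c false) ↔ p (D.traceEnd σ c true)) →
        ∀ v ∈ V, ∀ w ∈ V, p v → p w) :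
    D.firstBetti σ (E : Set D.Cr) + V.card = E.card + 1 := by
  classical
  -- `T` is the coboundary of the subgraph. By connectedness its kernel consists of the constants,
  -- and the cycle space is the orthogonal complement of its range; `finrank_rangePerp` then gives
  -- the formula.
  let T : (V → ℚ) →ₗ[ℚ] (E → ℚ) :=
    { toFun := fun f c => f ⟨_, hends c.1 c.2 true⟩ - f ⟨_, hends c.1 c.2 false⟩
      map_add' := fun f g => by ext c; simp; ring
      map_smul' := fun r f => by ext c; simp; ring }
  have hT := finrank_rangePerp T
  have hker : Module.finrank ℚ (LinearMap.ker T) = 1 := by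
    obtain ⟨v₀, hv₀⟩ := hV
    have h1 : (fun _ => 1 : V → ℚ) ∈ LinearMap.ker T := by
      rw [LinearMap.mem_ker]
      funext c
      exact sub_self 1
    refine finrank_eq_one (⟨fun _ => 1, h1⟩ : LinearMap.ker T) (fun h => ?_) ?_
    · exact one_ne_zero (congrFun (congrArg Subtype.val h) ⟨v₀, hv₀⟩)
    · rintro ⟨f, hf⟩
      refine ⟨f ⟨v₀, hv₀⟩, Subtype.ext (funext fun v => ?_)⟩
      change f ⟨v₀, hv₀⟩ * 1 = f v
      rw [mul_one]
      have := hconn (fun w => ∀ h : w ∈ V, f ⟨v₀, hv₀⟩ = f ⟨w, h⟩) (fun c hc => ?_) v₀ hv₀ v.1 v.2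
        fun _ => rfl
      · exact this v.2
      · have h : f ⟨_, hends c hc true⟩ = f ⟨_, hends c hc false⟩ :=
          sub_eq_zero.mp (congrFun (LinearMap.mem_ker.mp hf) ⟨c, hc⟩)
        constructor
        · exact fun h' _ => (h' (hends c hc false)).trans h.symm
        · exact fun h' _ => (h' (hends c hc true)).trans h
  have hsum : ∀ w : D.Cr → ℚ, (∀ c ∉ (E : Set D.Cr), w c = 0) → ∀ f : D.Loop σ → ℚ,
      T (fun v => f v.1) ⬝ᵥ (fun c : E => w c.1) =
        ∑ c, (f (D.traceEnd σ c true) - f (D.traceEnd σ c false)) * w c := by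
    intro w hw f
    refine Fintype.sum_of_injective (Subtype.val : E → D.Cr) Subtype.val_injective _ _
      (fun c hc => ?_) fun c => rfl
    rw [hw c (fun h => hc ⟨⟨c, h⟩, rfl⟩), mul_zero]
  have hperp : ∀ w : D.Cr → ℚ, (∀ c ∉ (E : Set D.Cr), w c = 0) →
      (w ∈ D.cycleSpace σ E ↔ (fun c : E => w c.1) ∈ rangePerp T) := by
    intro w hw
    rw [mem_cycleSpace_iff, mem_rangePerp]
    constructor
    · intro h f
      let g : D.Loop σ → ℚ := fun v => if h : v ∈ V then f ⟨v, h⟩ else 0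
      have h2 := (hsum w hw g).trans (h.2 g)
      simpa [g] using h2
    · intro h
      exact ⟨hw, fun f => by rw [← hsum w hw f, h]⟩
  have hequiv : Module.finrank ℚ (D.cycleSpace σ E) = Module.finrank ℚ (rangePerp T) := by
    refine LinearEquiv.finrank_eq (LinearEquiv.ofBijective
      (((LinearMap.funLeft ℚ ℚ (Subtype.val : E → D.Cr)) ∘ₗ (D.cycleSpace σ E).subtype).codRestrict
        (rangePerp T) ?_) ⟨?_, ?_⟩)
    · rintro ⟨w, hw⟩
      exact (hperp w (mem_cycleSpace_iff.mp hw).1).mp hw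
    · rintro ⟨w, hw⟩ ⟨w', hw'⟩ h
      refine Subtype.ext (funext fun c => ?_)
      by_cases hc : c ∈ E
      · exact congrFun (congrArg Subtype.val h) ⟨c, hc⟩
      · exact ((mem_cycleSpace_iff.mp hw).1 c hc).trans ((mem_cycleSpace_iff.mp hw').1 c hc).symm
    · rintro ⟨u, hu⟩
      have hext : (fun c : E => (fun c => if h : c ∈ E then u ⟨c, h⟩ else 0 : D.Cr → ℚ) c.1) = u := by
        funext c
        exact dif_pos c.2
      refine ⟨⟨fun c => if h : c ∈ E then u ⟨c, h⟩ else 0, ?_⟩, Subtype.ext hext⟩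
      exact (hperp _ fun c hc => dif_neg hc).mpr ((congrArg (· ∈ rangePerp T) hext).mpr hu)
  rw [firstBetti, hequiv]
  rw [hker, Fintype.card_coe, Fintype.card_coe] at hT
  exact hT

/-! ### The components of the graph of positive crossings -/

/-- The graph of positive crossings. -/
abbrev posGraph (D : LinkDiagram) : SimpleGraph (D.zeroLoops D.orientedState) :=
  D.zeroGraph D.orientedState

noncomputable instance : Fintype D.posGraph.ConnectedComponent :=
  Fintype.ofFinite _

noncomputable instance : Fintype (D.zeroLoops D.orientedState) := Fintype.ofFinite _

open Classical in
/-- The crossings of a component. -/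
noncomputable def compEdges (K : D.posGraph.ConnectedComponent) : Finset D.Cr :=
  Finset.univ.filter (· ∈ D.componentTraces D.orientedState K)

open Classical in
/-- The Seifert circles of a component. -/
noncomputable def compCircles (K : D.posGraph.ConnectedComponent) :
    Finset (D.Loop D.orientedState) :=
  (Finset.univ.filter (· ∈ K.supp)).map (Function.Embedding.subtype _)

theorem mem_compEdges {K : D.posGraph.ConnectedComponent} {c : D.Cr} :
    c ∈ compEdges K ↔ c ∈ D.componentTraces D.orientedState K := by
  simp [compEdges]

theorem mem_compCircles {K : D.posGraph.ConnectedComponent} {v : D.Loop D.orientedState} :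
    v ∈ compCircles K ↔
      ∃ h : v ∈ D.zeroLoops D.orientedState, D.posGraph.connectedComponentMk ⟨v, h⟩ = K := by
  classical
  simp [compCircles]

theorem mem_compCircles_coe {K : D.posGraph.ConnectedComponent} {v : D.zeroLoops D.orientedState} :
    v.1 ∈ compCircles K ↔ v ∈ K.supp := by
  rw [mem_compCircles]
  exact ⟨fun ⟨_, h⟩ => h, fun h => ⟨v.2, h⟩⟩

open Classical in
theorem sum_compCircles (K : D.posGraph.ConnectedComponent) (f : D.Loop D.orientedState → ℤ) :
    ∑ v ∈ compCircles K, f v = ∑ v : D.zeroLoops D.orientedState, if v ∈ K.supp then f v.1 else 0 := by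
  rw [compCircles, Finset.sum_map, Finset.sum_filter]
  rfl

theorem compCircles_nonempty (K : D.posGraph.ConnectedComponent) : (compCircles K).Nonempty := by
  obtain ⟨v, hv⟩ := K.exists_rep
  exact ⟨v.1, mem_compCircles_coe.mpr hv⟩

theorem compCircles_disjoint {K K' : D.posGraph.ConnectedComponent} (h : K ≠ K') :
    Disjoint (compCircles K) (compCircles K') := by
  rw [Finset.disjoint_left]
  intro v hv hv'
  obtain ⟨h1, h2⟩ := mem_compCircles.mp hv
  obtain ⟨h3, h4⟩ := mem_compCircles.mp hv'
  exact h (h2.symm.trans h4)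

theorem circle_port_mem_zeroLoops {c : D.Cr} (hc : D.pos c = true) (b : Bool) :
    D.circle (D.port (c, b)) ∈ D.zeroLoops D.orientedState :=
  ⟨c, mem_zeroTraces_orientedState.mpr hc, b, traceEnd_orientedState c b⟩

theorem connectedComponentMk_ends {c : D.Cr} (hc : D.pos c = true) :
    D.posGraph.connectedComponentMk ⟨_, circle_port_mem_zeroLoops hc true⟩ =
      D.posGraph.connectedComponentMk ⟨_, circle_port_mem_zeroLoops hc false⟩ := by
  -- A crossing with both ends on one circle is not an edge of the simple graph, but then the claim
  -- is trivial.
  by_cases h : D.circle (D.port (c, true)) = D.circle (D.port (c, false))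
  · congr 2
  · refine SimpleGraph.ConnectedComponent.sound (SimpleGraph.Adj.reachable ?_)
    refine (SimpleGraph.fromRel_adj _ _ _).mpr ⟨fun h' => h (congrArg Subtype.val h'), Or.inr ?_⟩
    exact ⟨c, mem_zeroTraces_orientedState.mpr hc, traceEnd_orientedState c false,
      traceEnd_orientedState c true⟩

theorem mem_compEdges_iff {K : D.posGraph.ConnectedComponent} {c : D.Cr} :
    c ∈ compEdges K ↔ D.pos c = true ∧ D.circle (D.port (c, false)) ∈ compCircles K := by
  rw [mem_compEdges, mem_compCircles]
  constructor
  · rintro ⟨h1, v, h2, h3⟩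
    rw [traceEnd_orientedState] at h2
    rw [mem_zeroTraces_orientedState] at h1
    exact ⟨h1, h2 ▸ v.2, by rw [← h3]; congr 1; exact Subtype.ext h2.symm⟩
  · rintro ⟨h1, h2, h3⟩
    exact ⟨mem_zeroTraces_orientedState.mpr h1, ⟨_, h2⟩, (traceEnd_orientedState c false).symm, h3⟩

theorem circle_port_mem_compCircles {K : D.posGraph.ConnectedComponent} {c : D.Cr}
    (hc : c ∈ compEdges K) (b : Bool) : D.circle (D.port (c, b)) ∈ compCircles K := by
  obtain ⟨h1, h2⟩ := mem_compEdges_iff.mp hc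
  cases b
  · exact h2
  · obtain ⟨h3, h4⟩ := mem_compCircles.mp h2
    exact mem_compCircles.mpr ⟨_, (connectedComponentMk_ends h1).trans h4⟩

theorem exists_crossing_of_adj {v w : D.zeroLoops D.orientedState} (h : D.posGraph.Adj v w) :
    ∃ c, D.pos c = true ∧ ∃ b, D.circle (D.port (c, b)) = v ∧ D.circle (D.port (c, !b)) = w := by
  obtain ⟨-, ⟨c, hc, h1, h2⟩ | ⟨c, hc, h1, h2⟩⟩ := (SimpleGraph.fromRel_adj _ _ _).mp h <;>
    rw [traceEnd_orientedState] at h1 h2 <;> rw [mem_zeroTraces_orientedState] at hc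
  · exact ⟨c, hc, false, h1, h2⟩
  · exact ⟨c, hc, true, h2, h1⟩

/-- This translates walks in the simple graph into the form of connectedness used for multigraphs: a
property that passes across every edge holds on all of the component once it holds somewhere. -/
theorem comp_connected (K : D.posGraph.ConnectedComponent) (p : D.Loop D.orientedState → Prop)
    (hp : ∀ c ∈ compEdges K, p (D.circle (D.port (c, false))) ↔ p (D.circle (D.port (c, true)))) :
    ∀ v ∈ compCircles K, ∀ w ∈ compCircles K, p v → p w := by
  intro v hv w hw
  obtain ⟨hv1, hv2⟩ := mem_compCircles.mp hv
  obtain ⟨hw1, hw2⟩ := mem_compCircles.mp hw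
  obtain ⟨walk⟩ := SimpleGraph.ConnectedComponent.exact (hv2.trans hw2.symm)
  have main : ∀ (a b : D.zeroLoops D.orientedState), D.posGraph.Walk a b →
      D.posGraph.connectedComponentMk a = K → p a.1 → p b.1 := by
    intro a b walk
    induction walk with
    | nil => exact fun _ h => h
    | @cons a b e hab _ ih =>
      intro ha hpa
      have hb : D.posGraph.connectedComponentMk b = K := by
        rw [← ha]
        exact SimpleGraph.ConnectedComponent.sound hab.symm.reachable
      refine ih hb ?_
      obtain ⟨c, hc, i, h1, h2⟩ := exists_crossing_of_adj hab
      have hcK : c ∈ compEdges K := by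
        refine mem_compEdges_iff.mpr ⟨hc, ?_⟩
        cases i
        · exact h1 ▸ mem_compCircles_coe.mpr ha
        · exact h2 ▸ mem_compCircles_coe.mpr hb
      cases i
      · rw [← h1] at hpa
        rw [← h2]
        exact (hp c hcK).mp hpa
      · rw [← h1] at hpa
        rw [← h2]
        exact (hp c hcK).mpr hpa
  exact main _ _ walk hv2

theorem firstBetti_component (K : D.posGraph.ConnectedComponent) :
    D.firstBetti D.orientedState (D.componentTraces D.orientedState K) + (compCircles K).card =
      (compEdges K).card + 1 := by
  have h : D.componentTraces D.orientedState K = (compEdges K : Set D.Cr) := by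
    ext c
    exact mem_compEdges.symm
  rw [h]
  refine firstBetti_add_card (compCircles_nonempty K) (fun c hc b => ?_) fun p hp => ?_
  · rw [traceEnd_orientedState]
    exact circle_port_mem_compCircles hc b
  · refine comp_connected K p fun c hc => ?_
    have := hp c hc
    rwa [traceEnd_orientedState, traceEnd_orientedState] at this

/-- Each step of a walk changes the colour, so the parity of the length of a shortest walk is the
product of the colours at its ends. -/
theorem coloring_dist {χ : D.Loop D.orientedState → ℤˣ}
    (hχ : ∀ c, χ (D.circle (D.port (c, true))) = -χ (D.circle (D.port (c, false))))
    {v w : D.zeroLoops D.orientedState} (h : D.posGraph.Reachable v w) :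
    (-1) ^ D.posGraph.dist v w = χ v.1 * χ w.1 := by
  obtain ⟨walk, hwalk⟩ := h.exists_walk_length_eq_dist
  rw [← hwalk]
  clear hwalk
  induction walk with
  | nil => rw [SimpleGraph.Walk.length_nil, pow_zero, Int.units_mul_self]
  | cons hab _ ih =>
    obtain ⟨c, -, i, h1, h2⟩ := exists_crossing_of_adj hab
    have h3 : χ (D.circle (D.port (c, i))) = -χ (D.circle (D.port (c, !i))) := by
      cases i
      · rw [Bool.not_false, hχ, neg_neg]
      · exact hχ c
    rw [SimpleGraph.Walk.length_cons, pow_succ, ih (SimpleGraph.Walk.reachable ‹_›), ← h1, ← h2, h3]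
    simp

theorem xSet_inter_eq_erase_iff {K : D.posGraph.ConnectedComponent}
    [DecidableEq (D.Loop D.orientedState)] [DecidableEq (D.zeroLoops D.orientedState)]
    {v : D.zeroLoops D.orientedState} {l : D.Loop D.orientedState → KhLabel} :
    xSet l ∩ compCircles K = (compCircles K).erase v.1 ↔
      ∀ w ∈ K.supp, l w.1 = if w = v then KhLabel.one else KhLabel.x := by
  constructor
  · intro h w hw
    have := Finset.ext_iff.mp h w.1
    simp only [Finset.mem_inter, mem_xSet, Finset.mem_erase, mem_compCircles_coe, hw, and_true,
      ne_eq, Subtype.coe_inj] at this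
    by_cases hwv : w = v
    · cases hl : l w.1 <;> simp_all
    · cases hl : l w.1 <;> simp_all
  · intro h
    ext w
    simp only [Finset.mem_inter, mem_xSet, Finset.mem_erase]
    rw [and_congr_left_iff]
    intro hw
    obtain ⟨hw1, hw2⟩ := mem_compCircles.mp hw
    have := h ⟨w, hw1⟩ hw2
    by_cases hwv : w = v.1
    · have hwv' : (⟨w, hw1⟩ : D.zeroLoops D.orientedState) = v := Subtype.ext hwv
      rw [if_pos hwv'] at this
      change l w = _ at this
      rw [this]
      simp [hwv]
    · have hwv' : (⟨w, hw1⟩ : D.zeroLoops D.orientedState) ≠ v :=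
        fun h => hwv (congrArg Subtype.val h)
      rw [if_neg hwv'] at this
      simp [this, hwv]

theorem xSet_inter_eq_iff {K : D.posGraph.ConnectedComponent}
    [DecidableEq (D.Loop D.orientedState)] {l : D.Loop D.orientedState → KhLabel} :
    xSet l ∩ compCircles K = compCircles K ↔ ∀ w ∈ K.supp, l w.1 = KhLabel.x := by
  rw [Finset.inter_eq_right]
  constructor
  · exact fun h w hw => mem_xSet.mp (h (mem_compCircles_coe.mpr hw))
  · intro h w hw
    obtain ⟨hw1, hw2⟩ := mem_compCircles.mp hw
    exact mem_xSet.mpr (h ⟨w, hw1⟩ hw2)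

/-! ### Factorisation over the components, and comparison with the described chain. -/

/-- The edge polynomial at the crossings in `E`. -/
noncomputable abbrev crossingPoly (E : Finset D.Cr) : MvPolynomial (D.Loop D.orientedState) ℤ :=
  edgePoly (fun c => D.circle (D.port (c, false))) (fun c => D.circle (D.port (c, true))) E

open Classical in
theorem coeff_component {χ : D.Loop D.orientedState → ℤˣ}
    (hχ : ∀ c, χ (D.circle (D.port (c, true))) = -χ (D.circle (D.port (c, false))))
    (K : D.posGraph.ConnectedComponent) {v₀ : D.zeroLoops D.orientedState}
    (hv₀ : D.posGraph.connectedComponentMk v₀ = K) :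
    ∃ ε : ℤˣ, ∀ l : D.Loop D.orientedState → KhLabel,
      (crossingPoly (compEdges K)).coeff (squareFree (xSet l ∩ compCircles K)) =
        ε * D.componentCoeff D.orientedState K v₀ l := by
  have hb := firstBetti_component K
  obtain ⟨ε, hε⟩ := coeff_edgePoly_connected (compCircles_nonempty K) (fun c _ => hχ c)
    (fun c hc => circle_port_mem_compCircles hc false)
    (fun c hc => circle_port_mem_compCircles hc true) (comp_connected K)
  by_cases h0 : D.firstBetti D.orientedState (D.componentTraces D.orientedState K) = 0
  -- For a tree the signs are `ε * χ v`, and `χ v = χ v₀ * (-1) ^ dist v₀ v`; the factor `χ v₀` goes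
  -- into the overall sign, so every base vertex is allowed.
  · refine ⟨ε * χ v₀.1, fun l => ?_⟩
    rw [hε _ Finset.inter_subset_right, if_pos (by omega), componentCoeff, if_pos h0,
      finsum_eq_sum_of_fintype, Units.val_mul, mul_assoc]
    congr 1
    rw [sum_compCircles, Finset.mul_sum]
    refine Finset.sum_congr rfl fun v _ => ?_
    rw [ite_and, mul_ite, mul_zero]
    refine ite_eq_ite_of_iff Iff.rfl fun hv => ?_
    rw [mul_ite, mul_zero]
    refine ite_eq_ite_of_iff xSet_inter_eq_erase_iff fun _ => ?_
    have h1 := coloring_dist hχ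
      (SimpleGraph.ConnectedComponent.exact (hv₀.trans (show _ = K from hv).symm))
    have h2 := congrArg (Units.val) h1
    push_cast at h2
    rw [h2, ← mul_assoc, ← Units.val_mul, Int.units_mul_self, Units.val_one, one_mul]
  · by_cases h1 : D.firstBetti D.orientedState (D.componentTraces D.orientedState K) = 1
    · refine ⟨ε, fun l => ?_⟩
      rw [hε _ Finset.inter_subset_right, if_neg (by omega), if_pos (by omega), componentCoeff,
        if_neg h0, if_pos h1]
      congr 1
      exact ite_eq_ite_of_iff xSet_inter_eq_iff fun _ => rfl
    · refine ⟨ε, fun l => ?_⟩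
      rw [hε _ Finset.inter_subset_right, if_neg (by omega), if_neg (by omega), componentCoeff,
        if_neg h0, if_neg h1]

/-- Each positive crossing belongs to exactly one component, that of the circle at its left port. -/
theorem seifertPoly_eq_prod_components :
    D.seifertPoly = ∏ K : D.posGraph.ConnectedComponent, crossingPoly (compEdges K) := by
  classical
  have h : D.posCr = Finset.univ.biUnion (compEdges (D := D)) := by
    ext c
    simp only [posCr, Finset.mem_filter, Finset.mem_univ, true_and, Finset.mem_biUnion,
      mem_compEdges_iff]
    constructor
    · exact fun hc => ⟨_, hc, mem_compCircles.mpr ⟨circle_port_mem_zeroLoops hc false, rfl⟩⟩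
    · exact fun ⟨_, hc, _⟩ => hc
  rw [seifertPoly, h]
  refine Finset.prod_biUnion fun K _ K' _ hKK' => ?_
  rw [Function.onFun, Finset.disjoint_left]
  intro c hc hc'
  exact Finset.disjoint_left.mp (compCircles_disjoint hKK') (mem_compEdges_iff.mp hc).2
    (mem_compEdges_iff.mp hc').2

/-- The coefficient of a labelling in `componentwiseChain`. -/
theorem componentwiseChain_apply
    (base : D.posGraph.ConnectedComponent → D.zeroLoops D.orientedState)
    (l : D.Loop D.orientedState → KhLabel)
    [Decidable (∀ v, v ∉ D.zeroLoops D.orientedState → l v = KhLabel.one)] :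
    D.componentwiseChain D.orientedState base (D.orientedEnhanced l) =
      if ∀ v, v ∉ D.zeroLoops D.orientedState → l v = KhLabel.one then
        ∏ K, D.componentCoeff D.orientedState K (base K) l else 0 := by
  classical
  rw [componentwiseChain, finsum_eq_sum_of_fintype, Finset.sum_apply, Finset.sum_eq_single l]
  · rw [Pi.smul_apply, gen_self, smul_eq_mul, mul_one, finprod_eq_prod_of_fintype]
    congr
  · intro l' _ hl'
    rw [Pi.smul_apply, gen_of_ne, smul_zero]
    intro h
    exact hl' (by simpa using h.symm)
  · exact fun h => absurd (Finset.mem_univ _) h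

theorem componentwiseChain_onOriented
    (base : D.posGraph.ConnectedComponent → D.zeroLoops D.orientedState) :
    OnOriented (D.componentwiseChain D.orientedState base) := by
  classical
  intro s hs
  rw [componentwiseChain, finsum_eq_sum_of_fintype, Finset.sum_apply]
  refine Finset.sum_eq_zero fun l _ => ?_
  rw [Pi.smul_apply, gen_of_ne, smul_zero]
  exact fun h => hs (congrArg Sigma.fst h)

theorem chain_ext {z z' : D.Chain} (hz : OnOriented z) (hz' : OnOriented z')
    (h : ∀ l, z (D.orientedEnhanced l) = z' (D.orientedEnhanced l)) : z = z' := by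
  funext ⟨σ, l⟩
  by_cases hσ : σ = D.orientedState
  · subst hσ
    exact h l
  · rw [hz _ hσ, hz' _ hσ]

theorem OnOriented.smul {R : Type*} [SMulZeroClass R ℤ] {z : D.Chain} (hz : OnOriented z) (r : R) :
    OnOriented (r • z) := fun s hs => by rw [Pi.smul_apply, hz s hs, smul_zero]

/-- The Seifert polynomial has the coefficients of `componentwiseChain`, up to an overall sign. -/
theorem coeff_seifertPoly {χ : D.Loop D.orientedState → ℤˣ}
    (hχ : ∀ c, χ (D.circle (D.port (c, true))) = -χ (D.circle (D.port (c, false))))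
    (base : D.posGraph.ConnectedComponent → D.zeroLoops D.orientedState)
    (hbase : ∀ K, D.posGraph.connectedComponentMk (base K) = K) :
    ∃ ε : ℤˣ, ∀ l, D.seifertPoly.coeff (squareFree (xSet l)) =
      ε * D.componentwiseChain D.orientedState base (D.orientedEnhanced l) := by
  classical
  choose ε hε using fun K => coeff_component hχ K (hbase K)
  refine ⟨∏ K, ε K, fun l => ?_⟩
  rw [seifertPoly_eq_prod_components, coeff_squareFree_prod _ compCircles
    (fun K => edgePoly_mem_supported _ _
      (fun c hc => by exact_mod_cast circle_port_mem_compCircles hc false)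
      fun c hc => by exact_mod_cast circle_port_mem_compCircles hc true)
    (fun K K' h => compCircles_disjoint h), componentwiseChain_apply, mul_ite, mul_zero]
  refine if_congr ?_ ?_ rfl
  · have h1 : ∀ v, v ∈ Finset.univ.biUnion (compCircles (D := D)) ↔
        v ∈ D.zeroLoops D.orientedState := by
      intro v
      simp only [Finset.mem_biUnion, Finset.mem_univ, true_and, mem_compCircles]
      exact ⟨fun ⟨_, h, _⟩ => h, fun h => ⟨_, h, rfl⟩⟩
    rw [Finset.subset_iff]
    refine forall_congr' fun v => ?_
    rw [h1, mem_xSet]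
    cases l v <;> simp
  · rw [Units.coe_prod, ← Finset.prod_mul_distrib]
    exact Finset.prod_congr rfl fun K _ => hε K l

/-- Both sides are supported on the oriented smoothing and agree, up to sign, with the Seifert
polynomial. Planarity is needed only for the colouring. -/
theorem SeifertMovie.cycleKJ_eq (hD : D.Planar) (m : D.SeifertMovie)
    (base : D.posGraph.ConnectedComponent → D.zeroLoops D.orientedState)
    (hbase : ∀ K, D.posGraph.connectedComponentMk (base K) = K) :
    ∃ ε : ℤˣ, m.cycleKJ = ε • D.componentwiseChain D.orientedState base := by
  obtain ⟨χ, hχ⟩ := hD.exists_coloring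
  obtain ⟨hon, ε, hε⟩ := Film.isSeifertChain m
  obtain ⟨η, hη⟩ := coeff_seifertPoly hχ base hbase
  refine ⟨ε * η, chain_ext hon ((componentwiseChain_onOriented base).smul _) fun l => ?_⟩
  rw [SeifertMovie.cycleKJ, hε, hη, Pi.smul_apply, Units.smul_def, smul_eq_mul, Units.val_mul,
    mul_assoc]

/-! ### Connected graphs of positive crossings -/

theorem componentTraces_of_connected (h : D.posGraph.Connected)
    (K : D.posGraph.ConnectedComponent) :
    D.componentTraces D.orientedState K = D.zeroTraces D.orientedState := by
  ext c
  refine ⟨fun hc => hc.1, fun hc => ⟨hc, ⟨_, c, hc, false, rfl⟩, rfl, ?_⟩⟩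
  exact @Subsingleton.elim _ h.preconnected.subsingleton_connectedComponent _ _

theorem componentwiseChain_of_connected (h : D.posGraph.Connected)
    (v₀ : D.zeroLoops D.orientedState) (l : D.Loop D.orientedState → KhLabel)
    [Decidable (∀ v, v ∉ D.zeroLoops D.orientedState → l v = KhLabel.one)] :
    D.componentwiseChain D.orientedState (fun _ => v₀) (D.orientedEnhanced l) =
      if ∀ v, v ∉ D.zeroLoops D.orientedState → l v = KhLabel.one then
        D.componentCoeff D.orientedState (D.posGraph.connectedComponentMk v₀) v₀ l else 0 := by
  have := h.preconnected.subsingleton_connectedComponent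
  rw [componentwiseChain_apply, Fintype.prod_subsingleton _ (D.posGraph.connectedComponentMk v₀)]

open Classical in
theorem gen_xOn_apply (S : Set (D.Loop D.orientedState)) (l : D.Loop D.orientedState → KhLabel) :
    gen (D.xOn D.orientedState S) (D.orientedEnhanced l) =
      if ∀ v, (v ∈ S → l v = KhLabel.x) ∧ (v ∉ S → l v = KhLabel.one) then 1 else 0 := by
  have hiff : D.orientedEnhanced l = D.xOn D.orientedState S ↔
      ∀ v, (v ∈ S → l v = KhLabel.x) ∧ (v ∉ S → l v = KhLabel.one) := by
    have h1 : D.orientedEnhanced l = D.xOn D.orientedState S ↔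
        ∀ v, l v = if v ∈ S then KhLabel.x else KhLabel.one := by
      rw [← funext_iff]
      simp [xOn]
    rw [h1]
    refine forall_congr' fun v => ?_
    by_cases hv : v ∈ S <;> simp [hv]
  split_ifs with h
  · rw [hiff.mpr h, gen_self]
  · exact gen_of_ne fun h' => h (hiff.mp h')

theorem gen_xOn_onOriented (S : Set (D.Loop D.orientedState)) :
    OnOriented (gen (D.xOn D.orientedState S)) := by
  intro s hs
  exact gen_of_ne fun h => hs (congrArg Sigma.fst h)

theorem componentwiseChain_eq_pqrChain (h : D.posGraph.Connected)
    (hb : D.firstBetti D.orientedState (D.zeroTraces D.orientedState) = 0)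
    (v₀ : D.zeroLoops D.orientedState) :
    D.componentwiseChain D.orientedState (fun _ => v₀) =
      D.pqrChain D.orientedState (D.zeroLoops D.orientedState)
        fun v => (-1) ^ D.posGraph.dist v₀ v := by
  classical
  have hsupp : ∀ v, v ∈ (D.posGraph.connectedComponentMk v₀).supp := fun v =>
    @Subsingleton.elim _ h.preconnected.subsingleton_connectedComponent _ _
  refine chain_ext (componentwiseChain_onOriented _) (fun s hs => ?_) fun l => ?_
  · rw [pqrChain, finsum_eq_sum_of_fintype, Finset.sum_apply]
    exact Finset.sum_eq_zero fun v _ => (gen_xOn_onOriented _).smul _ s hs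
  -- The left side is the condition in `componentwiseChain`, split into circles off and on `Γ₀`; the
  -- right side is the condition that `l` is the labelling of a summand of the `pqr`-chain.
  · have hiff : ∀ v : D.zeroLoops D.orientedState,
        ((∀ u, u ∉ D.zeroLoops D.orientedState → l u = KhLabel.one) ∧
          ∀ w : D.zeroLoops D.orientedState,
            l w.1 = if w = v then KhLabel.one else KhLabel.x) ↔
        ∀ u, (u ∈ D.zeroLoops D.orientedState \ {v.1} → l u = KhLabel.x) ∧
          (u ∉ D.zeroLoops D.orientedState \ {v.1} → l u = KhLabel.one) := by
      intro v
      constructor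
      · rintro ⟨h1, h2⟩ u
        refine ⟨fun hu => ?_, fun hu => ?_⟩
        · have h3 := h2 ⟨u, hu.1⟩
          have h4 : (⟨u, hu.1⟩ : D.zeroLoops D.orientedState) ≠ v :=
            fun h => hu.2 (congrArg Subtype.val h)
          rwa [if_neg h4] at h3
        · by_cases hu' : u ∈ D.zeroLoops D.orientedState
          · have h3 := h2 ⟨u, hu'⟩
            rwa [if_pos] at h3
            by_contra h4
            exact hu ⟨hu', fun h => h4 (Subtype.ext h)⟩
          · exact h1 u hu'
      · intro h1
        refine ⟨fun u hu => (h1 u).2 fun h => hu h.1, fun w => ?_⟩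
        split_ifs with hwv
        · exact (h1 w.1).2 fun h => h.2 (congrArg Subtype.val hwv)
        · exact (h1 w.1).1 ⟨w.2, fun h => hwv (Subtype.ext h)⟩
    rw [componentwiseChain_of_connected h, componentCoeff, componentTraces_of_connected h,
      if_pos hb, pqrChain, finsum_eq_sum_of_fintype, finsum_eq_sum_of_fintype, Finset.sum_apply]
    simp only [hsupp, true_and, forall_const, Pi.smul_apply, gen_xOn_apply, ← hiff, smul_eq_mul,
      mul_ite, mul_one, mul_zero]
    split_ifs with hc
    · simp only [and_iff_right hc]
    · simp_rw [eq_false hc, false_and, if_false, Finset.sum_const_zero]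

theorem componentwiseChain_eq_two_smul (h : D.posGraph.Connected)
    (hb : D.firstBetti D.orientedState (D.zeroTraces D.orientedState) = 1)
    (v₀ : D.zeroLoops D.orientedState) :
    D.componentwiseChain D.orientedState (fun _ => v₀) =
      (2 : ℤ) • gen (D.xOn D.orientedState (D.zeroLoops D.orientedState)) := by
  classical
  have hsupp : ∀ v, v ∈ (D.posGraph.connectedComponentMk v₀).supp := fun v =>
    @Subsingleton.elim _ h.preconnected.subsingleton_connectedComponent _ _
  refine chain_ext (componentwiseChain_onOriented _) ((gen_xOn_onOriented _).smul _) fun l => ?_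
  have h0 : D.firstBetti D.orientedState (D.zeroTraces D.orientedState) ≠ 0 := by omega
  have hiff : ((∀ u, u ∉ D.zeroLoops D.orientedState → l u = KhLabel.one) ∧
      ∀ w : D.zeroLoops D.orientedState, l w.1 = KhLabel.x) ↔
      ∀ u, (u ∈ D.zeroLoops D.orientedState → l u = KhLabel.x) ∧
        (u ∉ D.zeroLoops D.orientedState → l u = KhLabel.one) :=
    ⟨fun h u => ⟨fun hu => h.2 ⟨u, hu⟩, h.1 u⟩,
      fun h => ⟨fun u => (h u).2, fun w => (h w.1).1 w.2⟩⟩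
  rw [componentwiseChain_of_connected h, componentCoeff, componentTraces_of_connected h,
    if_neg h0, if_pos hb]
  simp only [hsupp, forall_const, Pi.smul_apply, gen_xOn_apply, ← hiff, smul_eq_mul,
    mul_ite, mul_one, mul_zero, ite_and]

theorem componentwiseChain_eq_zero (h : D.posGraph.Connected)
    (hb : 2 ≤ D.firstBetti D.orientedState (D.zeroTraces D.orientedState))
    (v₀ : D.zeroLoops D.orientedState) :
    D.componentwiseChain D.orientedState (fun _ => v₀) = 0 := by
  classical
  refine chain_ext (componentwiseChain_onOriented _) (fun _ _ => rfl) fun l => ?_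
  have h0 : D.firstBetti D.orientedState (D.zeroTraces D.orientedState) ≠ 0 := by omega
  have h1 : D.firstBetti D.orientedState (D.zeroTraces D.orientedState) ≠ 1 := by omega
  rw [componentwiseChain_of_connected h, componentCoeff, componentTraces_of_connected h,
    if_neg h0, if_neg h1, ite_self]
  rfl

end LinkDiagram

theorem mainTheorem7 (D : LinkDiagram) (hD : D.Planar) (m : D.SeifertMovie) :
    (∀ base : (D.zeroGraph D.orientedState).ConnectedComponent → D.zeroLoops D.orientedState,
      (∀ K, (D.zeroGraph D.orientedState).connectedComponentMk (base K) = K) →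
      ∃ ε : ℤˣ, m.cycleKJ = ε • D.componentwiseChain D.orientedState base) ∧
    ((D.zeroGraph D.orientedState).Connected →
      (D.firstBetti D.orientedState (D.zeroTraces D.orientedState) = 0 →
        ∀ v₀ : D.zeroLoops D.orientedState, ∃ ε : ℤˣ,
          m.cycleKJ = ε • D.pqrChain D.orientedState (D.zeroLoops D.orientedState)
            (fun v => (-1) ^ (D.zeroGraph D.orientedState).dist v₀ v)) ∧
      (D.firstBetti D.orientedState (D.zeroTraces D.orientedState) = 1 →
        ∃ ε : ℤˣ, m.cycleKJ =
          ε • (2 : ℤ) • LinkDiagram.gen (D.xOn D.orientedState (D.zeroLoops D.orientedState))) ∧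
      (2 ≤ D.firstBetti D.orientedState (D.zeroTraces D.orientedState) →
        m.cycleKJ = 0)) := by
  refine ⟨fun base hbase => m.cycleKJ_eq hD base hbase, fun hconn => ?_⟩
  have hbase : ∀ (v₀ : D.zeroLoops D.orientedState) (K : D.posGraph.ConnectedComponent),
      D.posGraph.connectedComponentMk v₀ = K := fun v₀ K =>
    @Subsingleton.elim _ hconn.preconnected.subsingleton_connectedComponent _ _
  refine ⟨fun hb v₀ => ?_, fun hb => ?_, fun hb => ?_⟩
  · rw [← LinkDiagram.componentwiseChain_eq_pqrChain hconn hb v₀]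
    exact m.cycleKJ_eq hD _ (hbase v₀)
  -- The conclusion mentions no base vertex, so any one will serve.
  · obtain ⟨v₀⟩ := hconn.nonempty
    rw [← LinkDiagram.componentwiseChain_eq_two_smul hconn hb v₀]
    exact m.cycleKJ_eq hD _ (hbase v₀)
  · obtain ⟨v₀⟩ := hconn.nonempty
    obtain ⟨ε, h⟩ := m.cycleKJ_eq hD _ (hbase v₀)
    rw [h, LinkDiagram.componentwiseChain_eq_zero hconn hb v₀, smul_zero]
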